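/- **Setting.** Let $d\ge 0$, let $\mathrm{Pol}(\mathbb R^d)=\mathbb C[x_1,\dots,x_d]$ be the complex-valued polynomial functions on $\mathbb R^d$, and for $K\in\mathbb N_0^d$ write $x^K=x_1^{K_1}\cdots x_d^{K_d}$, $|K|=K_1+\dots+K_d$. For $1\le i<j\le d$ let $\widetilde\phi(x_jx_i)\in t\,\mathbb C[x_1,\dots,x_d][[t]]$. A *reduction* of an element of $\mathbb C\langle x_1,\dots,x_d\rangle[[t]]$ replaces, simultaneously in every word, the right-most factor $x_jx_i$ with $i<j$ by $x_ix_j+\widetilde\phi(x_jx_i)$, where the monomials of $\widetilde\phi(x_jx_i)$ are written as words $x_1^{J_1}\cdots x_d^{J_d}$; such standard words are left unchanged. The *combinatorial star product* $\star$ associated to $\widetilde\phi$ is the $\mathbb C[[t]]$-bilinear operation on $\mathrm{Pol}(\mathbb R^d)[[t]]$, written $f\star g=\sum_{n\ge 0}t^nB_n(f,g)$ for polynomials $f,g$, such that $x^K\star x^L$ is the ($t$-adic) result of iterated reduction of the word $x^Kx^L$. It *quantizes* a polynomial Poisson structure $\eta$ on $\mathbb R^d$ (with coefficients in $\mathbb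 C$, for instance real) if it is associative with unit $1$, $B_0(f,g)=fg$, and $B_1(f,g)-B_1(g,f)=\mathrm i\{f,g\}_\eta$. The *MacGyver topology* on $\mathrm{Pol}(\mathbb R^d)$ is the locally convex topology given by the norms $\|\sum_L f_Lx^L\|_C=\sum_L|f_L|\,C^{|L|^2}$, $C\in(0,\infty)$; $\widehat{\mathrm{Pol}}(\mathbb R^d)$ denotes the completion. A map from an open subset of $\mathbb C$ to $\widehat{\mathrm{Pol}}(\mathbb R^d)$ is *holomorphic* if its composition with every continuous linear functional is. **Theorem.** Let $\Omega\subset\mathbb C$ be an open connected neighbourhood of $0$ and let $\star$ be a combinatorial star product quantizing a polynomial Poisson structure $\eta$ on $\mathbb R^d$. Assume: (a) for all $1\le i,j\le d$ one has $x_i\star x_j=\sum_K q_{i,j,K}x^K$, where only finitely many $q_{i,j,K}\in\mathbb C[[t]]$ are non-zero and each is the power series expansion at $0$ of a holomorphic function on $\Omega$; (b) there is a constant $\alpha$ such that for all $K,L$ at most $\alpha(|K|+|L|)^2$ reductions bring the word $x^Kx^L$ into a combination of standard words; (c) there is a constant $\beta$ such that for all $K,L$ only monomials of degree at most $\beta(|K|+|L|)$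 occur in $x^K\star x^L$. Then the following hold. 1. There is exactly one family of bilinear products $\star_\hbar$ on $\mathrm{Pol}(\mathbb R^d)$, $\hbar\in\Omega$, obtained from $\star$ by evaluating $t\mapsto\hbar$, i.e. such that for all polynomials $f,g$ the coefficients of $f\star_\hbar g$ are holomorphic in $\hbar\in\Omega$ with power series expansion at $0$ given by the coefficients of $f\star g$. For every $\hbar\in\Omega$ the product $\star_\hbar$ is continuous for the MacGyver topology and extends uniquely to a continuous bilinear product $\star_\hbar$ on $\widehat{\mathrm{Pol}}(\mathbb R^d)$, which is associative. 2. The evaluation of polynomials at the points of $\mathbb R^d$ extends continuously to $\widehat{\mathrm{Pol}}(\mathbb R^d)$ and identifies it with a space of smooth functions on $\mathbb R^d$ that is closed under $\{-,-\}_\eta$. For all $f,g\in\widehat{\mathrm{Pol}}(\mathbb R^d)$ the maps $\Omega\to\widehat{\mathrm{Pol}}(\mathbb R^d)$, $\hbar\mapsto f\star_\hbar g$ and $$\hbar\mapsto\begin{cases}\frac1{\mathrm i\hbar}(f\star_\hbar g-g\star_\hbar f)&\hbar\ne0\\ \{f,g\}_\eta&\hbar=0\end{cases}$$ are holomorphic.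 3. The $B_n$ extend to continuous bilinear maps on $\widehat{\mathrm{Pol}}(\mathbb R^d)$, and if $D\subset\Omega$ is an open disc around $0$, then $f\star_\hbar g=\sum_{n\ge0}\hbar^nB_n(f,g)$ for all $\hbar\in D$ and $f,g\in\widehat{\mathrm{Pol}}(\mathbb R^d)$, where the series converges absolutely and uniformly on compact subsets of $D$. 4. For every $\varepsilon>0$ with $[0,\varepsilon)\subset\Omega$, the family $(\widehat{\mathrm{Pol}}(\mathbb R^d),\star_\hbar)_{\hbar\in[0,\varepsilon)}$ is a strict deformation quantization of $(\mathbb R^d,\eta)$: the $(\widehat{\mathrm{Pol}}(\mathbb R^d),\star_\hbar)$ are associative Fréchet algebras on a common Fréchet space of smooth functions containing $\mathrm{Pol}(\mathbb R^d)$ and closed under $\{-,-\}_\eta$, $\star_0$ is the pointwise product, and for all $f,g$ the map $\hbar\mapsto f\star_\hbar g$ is continuous on $[0,\varepsilon)$ and $\frac1{\mathrm i\hbar}(f\star_\hbar g-g\star_\hbar f)\to\{f,g\}_\eta$ as $\hbar\to0$. -/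

import Mathlib

open Filter Topology

noncomputable section

namespace CombStar

/-- The polynomial functions on `ℝ^d` with complex coefficients. -/
abbrev Pol (d : ℕ) : Type := MvPolynomial (Fin d) ℂ

/-- The free associative algebra `ℂ⟨x_1, …, x_d⟩`, with basis the words in the letters `x_i`. -/
abbrev FreeAlg (d : ℕ) : Type := MonoidAlgebra ℂ (FreeMonoid (Fin d))

variable {d : ℕ}

/-! ### Words and reductions -/

/-- A word as an element of the free algebra. -/
def word (w : List (Fin d)) : FreeAlg d := MonoidAlgebra.single (FreeMonoid.ofList w) 1

/-- The standard word `x_1 ⋯ x_1 x_2 ⋯ x_2 ⋯ x_d ⋯ x_d` of the monomial `x^K`. -/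
def stdWord (K : Fin d →₀ ℕ) : List (Fin d) :=
  (List.finRange d).flatMap fun i => List.replicate (K i) i

/-- A word is standard if its letters are weakly increasing, i.e. if it is of the form
`x_1^{J_1} ⋯ x_d^{J_d}`. -/
abbrev IsStdWord (w : List (Fin d)) : Prop := w.Pairwise (· ≤ ·)

/-- The linear embedding `ℂ[x_1, …, x_d] → ℂ⟨x_1, …, x_d⟩` sending `x^K` to its standard word. -/
def stdLift : Pol d →ₗ[ℂ] FreeAlg d :=
  (MvPolynomial.basisMonomials (Fin d) ℂ).constr ℂ fun K => word (stdWord K)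

/-- The quotient map `ℂ⟨x_1, …, x_d⟩ → ℂ[x_1, …, x_d]`. -/
def abelianize : FreeAlg d →ₐ[ℂ] Pol d :=
  MonoidAlgebra.lift ℂ (Pol d) (FreeMonoid (Fin d)) (FreeMonoid.lift MvPolynomial.X)

/-- One reduction of a word: its right-most factor `x_a x_b` with `b < a` is replaced by
`x_b x_a + φ (x_a x_b)`, the terms of `φ (x_a x_b)` being written as standard words; standard words
are left unchanged. Here `φ a b` stands for `φ (x_a x_b)`; only its values for `b < a` are used. -/
def reduceWord (φ : Fin d → Fin d → PowerSeries (Pol d)) :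
    List (Fin d) → PowerSeries (FreeAlg d)
  | [] => 1
  | [a] => PowerSeries.C (word [a])
  | a :: b :: v =>
    if IsStdWord (b :: v) then
      if b < a then
        (PowerSeries.C (word [b, a]) + PowerSeries.mk fun n => stdLift (PowerSeries.coeff n (φ a b)))
          * PowerSeries.C (word v)
      else PowerSeries.C (word (a :: b :: v))
    else PowerSeries.C (word [a]) * reduceWord φ (b :: v)

/-- The coefficient of `t^n` of one reduction, extended linearly to the free algebra. -/
def reduceCoeff (φ : Fin d → Fin d → PowerSeries (Pol d)) (n : ℕ) : FreeAlg d →ₗ[ℂ] FreeAlg d :=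
  Finsupp.linearCombination ℂ
    (fun w : FreeMonoid (Fin d) => PowerSeries.coeff n (reduceWord φ w.toList)) ∘ₗ
    (MonoidAlgebra.coeffLinearEquiv ℂ).toLinearMap

/-- One reduction, performed simultaneously in each word of an element of `ℂ⟨x_1, …, x_d⟩⟦t⟧`. -/
def reduce (φ : Fin d → Fin d → PowerSeries (Pol d)) (F : PowerSeries (FreeAlg d)) :
    PowerSeries (FreeAlg d) :=
  PowerSeries.mk fun n =>
    ∑ p ∈ Finset.HasAntidiagonal.antidiagonal n, reduceCoeff φ p.2 (PowerSeries.coeff p.1 F)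

/-- Only standard words occur in `F`. -/
def IsStandard (F : PowerSeries (FreeAlg d)) : Prop :=
  ∀ n, ∀ w ∈ (PowerSeries.coeff n F).coeff.support, IsStdWord w.toList

/-- The product `x^K x^L`, viewed as an element of `ℂ⟨x_1, …, x_d⟩⟦t⟧`. -/
def wordProduct (K L : Fin d →₀ ℕ) : PowerSeries (FreeAlg d) :=
  PowerSeries.C (word (stdWord K ++ stdWord L))

/-! ### The iterated reductions stabilize `t`-adically -/

lemma coeff_reduce (φ : Fin d → Fin d → PowerSeries (Pol d)) (F : PowerSeries (FreeAlg d)) (n : ℕ) :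
    PowerSeries.coeff n (reduce φ F) =
      ∑ p ∈ Finset.HasAntidiagonal.antidiagonal n, reduceCoeff φ p.2 (PowerSeries.coeff p.1 F) := by
  simp [reduce]

lemma reduce_add (φ : Fin d → Fin d → PowerSeries (Pol d)) (F G : PowerSeries (FreeAlg d)) :
    reduce φ (F + G) = reduce φ F + reduce φ G := by
  ext1 n
  simp [coeff_reduce, Finset.sum_add_distrib]

lemma reduce_smul (φ : Fin d → Fin d → PowerSeries (Pol d)) (c : ℂ) (F : PowerSeries (FreeAlg d)) :
    reduce φ (c • F) = c • reduce φ F := by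
  ext1 n
  simp [coeff_reduce, Finset.smul_sum]

lemma reduce_X_mul (φ : Fin d → Fin d → PowerSeries (Pol d)) (F : PowerSeries (FreeAlg d)) :
    reduce φ (PowerSeries.X * F) = PowerSeries.X * reduce φ F := by
  ext1 n
  cases n with
  | zero => simp [coeff_reduce]
  | succ n =>
    rw [PowerSeries.coeff_succ_X_mul, coeff_reduce, coeff_reduce,
      Finset.Nat.sum_antidiagonal_succ]
    simp [PowerSeries.coeff_succ_X_mul]

lemma reduce_C_word (φ : Fin d → Fin d → PowerSeries (Pol d)) (w : List (Fin d)) :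
    reduce φ (PowerSeries.C (word w)) = reduceWord φ w := by
  ext1 n
  rw [coeff_reduce, Finset.sum_eq_single (0, n)]
  · simp [reduceCoeff, word, MonoidAlgebra.coeffLinearEquiv]
  · rintro ⟨a, b⟩ hab hne
    have : a ≠ 0 := by
      rintro rfl
      simp at hab
      exact hne (by simp [hab])
    simp [PowerSeries.coeff_C, this]
  · simp

lemma word_append (u v : List (Fin d)) : word (u ++ v) = word u * word v := by
  simp [word, MonoidAlgebra.single_mul_single]

lemma word_nil : word ([] : List (Fin d)) = 1 := rfl

/-- The number of inversions of a word. -/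
def inversions : List (Fin d) → ℕ
  | [] => 0
  | a :: l => l.countP (· < a) + inversions l

lemma reduceWord_std (φ : Fin d → Fin d → PowerSeries (Pol d)) (w : List (Fin d))
    (hw : IsStdWord w) : reduceWord φ w = PowerSeries.C (word w) := by
  match w with
  | [] => simp [reduceWord, word_nil]
  | [a] => simp [reduceWord]
  | a :: b :: v =>
    have h1 : IsStdWord (b :: v) := hw.of_cons
    have h2 : ¬ b < a := not_lt.2 (List.rel_of_pairwise_cons hw (by simp))
    simp [reduceWord, h1, h2]

lemma reduceWord_eq (φ : Fin d → Fin d → PowerSeries (Pol d))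
    (hφ : ∀ i j, i < j → PowerSeries.constantCoeff (φ j i) = 0) (w : List (Fin d))
    (hw : ¬ IsStdWord w) : ∃ (w' : List (Fin d)) (G : PowerSeries (FreeAlg d)),
      w'.Perm w ∧ inversions w' < inversions w ∧
      reduceWord φ w = PowerSeries.C (word w') + PowerSeries.X * G := by
  match w with
  | [] => simp [IsStdWord] at hw
  | [a] => simp [IsStdWord] at hw
  | a :: b :: v =>
    by_cases h1 : IsStdWord (b :: v)
    · by_cases h2 : b < a
      · have hX : PowerSeries.X ∣
            (PowerSeries.mk fun n => stdLift (PowerSeries.coeff n (φ a b))) := by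
          rw [PowerSeries.X_dvd_iff]
          simp [hφ b a h2]
        obtain ⟨G, hG⟩ := hX
        refine ⟨b :: a :: v, G * PowerSeries.C (word v), List.Perm.swap _ _ _, ?_, ?_⟩
        · simp [inversions, h2, not_lt.2 h2.le]
          omega
        · have : word (b :: a :: v) = word [b, a] * word v := word_append [b, a] v
          simp only [reduceWord, h1, h2, if_true, hG, this, map_mul, add_mul, mul_assoc]
      · exfalso
        refine hw (List.pairwise_cons.2 ⟨fun c hc => ?_, h1⟩)
        rcases List.mem_cons.1 hc with rfl | hc
        · exact not_lt.1 h2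
        · exact (not_lt.1 h2).trans (List.rel_of_pairwise_cons h1 hc)
    · obtain ⟨w', G, hp, hi, he⟩ := reduceWord_eq φ hφ (b :: v) h1
      refine ⟨a :: w', PowerSeries.C (word [a]) * G, hp.cons a, ?_, ?_⟩
      · have := hp.countP_eq (· < a)
        simp only [inversions] at hi ⊢
        rw [this]
        simp only [List.countP_cons] at *
        omega
      · have : word (a :: w') = word [a] * word w' := word_append [a] w'
        rw [reduceWord, if_neg h1, he, this, map_mul, mul_add, ← mul_assoc, ← mul_assoc,
          PowerSeries.commute_X]

/-- The coefficient of `t^m` of the iterated reductions of `F` is eventually constant, and only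
standard words occur in its final value. -/
def Stabilizes (φ : Fin d → Fin d → PowerSeries (Pol d)) (m : ℕ) (F : PowerSeries (FreeAlg d)) :
    Prop :=
  ∃ c : FreeAlg d, (∀ w ∈ c.coeff.support, IsStdWord w.toList) ∧
    ∀ᶠ N in atTop, PowerSeries.coeff m ((reduce φ)^[N] F) = c

lemma iterate_add (φ : Fin d → Fin d → PowerSeries (Pol d)) (N : ℕ) (F G : PowerSeries (FreeAlg d)) :
    (reduce φ)^[N] (F + G) = (reduce φ)^[N] F + (reduce φ)^[N] G := by
  induction N generalizing F G with
  | zero => rfl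
  | succ N ih => simp [reduce_add, ih]

lemma iterate_smul (φ : Fin d → Fin d → PowerSeries (Pol d)) (N : ℕ) (c : ℂ)
    (F : PowerSeries (FreeAlg d)) :
    (reduce φ)^[N] (c • F) = c • (reduce φ)^[N] F := by
  induction N generalizing F with
  | zero => rfl
  | succ N ih => simp [reduce_smul, ih]

lemma iterate_X_mul (φ : Fin d → Fin d → PowerSeries (Pol d)) (N : ℕ) (F : PowerSeries (FreeAlg d)) :
    (reduce φ)^[N] (PowerSeries.X * F) = PowerSeries.X * (reduce φ)^[N] F := by
  induction N generalizing F with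
  | zero => rfl
  | succ N ih => simp [reduce_X_mul, ih]

lemma Stabilizes.add {φ : Fin d → Fin d → PowerSeries (Pol d)} {m : ℕ} {F G : PowerSeries (FreeAlg d)}
    (hF : Stabilizes φ m F) (hG : Stabilizes φ m G) : Stabilizes φ m (F + G) := by
  obtain ⟨c, hc, h⟩ := hF
  obtain ⟨c', hc', h'⟩ := hG
  refine ⟨c + c', fun w hw => ?_, ?_⟩
  · by_cases h0 : w ∈ c.coeff.support
    · exact hc w h0
    · refine hc' w ?_
      simp only [Finsupp.mem_support_iff, not_not, MonoidAlgebra.coeff_add,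
        Finsupp.add_apply] at *
      simpa [h0] using hw
  · filter_upwards [h, h'] with N h h'
    simp [iterate_add, h, h']

lemma Stabilizes.smul {φ : Fin d → Fin d → PowerSeries (Pol d)} {m : ℕ} {F : PowerSeries (FreeAlg d)}
    (a : ℂ) (hF : Stabilizes φ m F) : Stabilizes φ m (a • F) := by
  obtain ⟨c, hc, h⟩ := hF
  refine ⟨a • c, fun w hw => hc w ?_, ?_⟩
  · simp only [Finsupp.mem_support_iff, MonoidAlgebra.coeff_smul, Finsupp.smul_apply] at *
    exact fun h0 => hw (by simp [h0])
  · filter_upwards [h] with N h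
    simp [iterate_smul, h]

lemma Stabilizes.X_mul {φ : Fin d → Fin d → PowerSeries (Pol d)} {m : ℕ}
    {F : PowerSeries (FreeAlg d)} (hF : ∀ k < m, Stabilizes φ k F) :
    Stabilizes φ m (PowerSeries.X * F) := by
  cases m with
  | zero => exact ⟨0, by simp, by simp [iterate_X_mul]⟩
  | succ m =>
    obtain ⟨c, hc, h⟩ := hF m (Nat.lt_succ_self m)
    refine ⟨c, hc, ?_⟩
    filter_upwards [h] with N h
    simp [iterate_X_mul, PowerSeries.coeff_succ_X_mul, h]

lemma Stabilizes.of_reduce {φ : Fin d → Fin d → PowerSeries (Pol d)} {m : ℕ}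
    {F : PowerSeries (FreeAlg d)} (hF : Stabilizes φ m (reduce φ F)) : Stabilizes φ m F := by
  obtain ⟨c, hc, h⟩ := hF
  refine ⟨c, hc, ?_⟩
  rw [eventually_atTop] at *
  obtain ⟨N, hN⟩ := h
  refine ⟨N + 1, fun n hn => ?_⟩
  obtain ⟨k, rfl⟩ := Nat.exists_eq_add_of_le' hn
  rw [← add_assoc, Function.iterate_succ_apply]
  exact hN _ (by omega)

/-- The recursive reordering is well defined at all orders of `t`. -/
theorem stabilizes (φ : Fin d → Fin d → PowerSeries (Pol d))
    (hφ : ∀ i j, i < j → PowerSeries.constantCoeff (φ j i) = 0) (m : ℕ)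
    (F : PowerSeries (FreeAlg d)) : Stabilizes φ m F := by
  induction m using Nat.strong_induction_on generalizing F with
  | _ m ih =>
    have hword : ∀ (n : ℕ) (w : List (Fin d)), inversions w = n →
        Stabilizes φ m (PowerSeries.C (word w)) := by
      intro n
      induction n using Nat.strong_induction_on with
      | _ n ihn =>
        intro w hn
        by_cases hw : IsStdWord w
        · have hfix : ∀ N, (reduce φ)^[N] (PowerSeries.C (word w)) = PowerSeries.C (word w) :=
            fun N => Function.iterate_fixed (by rw [reduce_C_word, reduceWord_std φ w hw]) N
          refine ⟨PowerSeries.coeff m (PowerSeries.C (word w)), fun v hv => ?_, by simp [hfix]⟩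
          rw [PowerSeries.coeff_C] at hv
          split_ifs at hv
          · have := Finsupp.support_single_subset hv
            simp only [Finset.mem_singleton] at this
            subst this
            exact hw
          · simp at hv
        · obtain ⟨w', G, -, hi, he⟩ := reduceWord_eq φ hφ w hw
          refine Stabilizes.of_reduce ?_
          rw [reduce_C_word, he]
          exact (ihn _ (hn ▸ hi) w' rfl).add (Stabilizes.X_mul fun k hk => ih k hk G)
    have hC : ∀ c : FreeAlg d, Stabilizes φ m (PowerSeries.C c) := by
      intro c
      induction c using MonoidAlgebra.induction_on with
      | of w => exact hword _ w.toList rfl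
      | add f g hf hg => rw [map_add]; exact hf.add hg
      | smul r f hf =>
        have : PowerSeries.C (r • f) = r • PowerSeries.C f := by
          ext1 n
          simp only [PowerSeries.coeff_C, PowerSeries.coeff_smul, smul_ite, smul_zero]
        rw [this]
        exact hf.smul r
    have := (Stabilizes.X_mul fun k hk =>
      ih k hk (PowerSeries.mk fun p => PowerSeries.coeff (p + 1) F)).add
        (hC (PowerSeries.constantCoeff F))
    rwa [← PowerSeries.eq_X_mul_shift_add_const F] at this

open Classical in
/-- The normal form of `F`: the `t`-adic limit of the iterated reductions of `F`. It exists by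
`stabilizes` as soon as `φ` starts in first order in `t`. -/
def normalForm (φ : Fin d → Fin d → PowerSeries (Pol d)) (F : PowerSeries (FreeAlg d)) :
    PowerSeries (FreeAlg d) :=
  PowerSeries.mk fun m => if h : Stabilizes φ m F then h.choose else 0

lemma normalForm_spec (φ : Fin d → Fin d → PowerSeries (Pol d))
    (hφ : ∀ i j, i < j → PowerSeries.constantCoeff (φ j i) = 0) (F : PowerSeries (FreeAlg d)) :
    IsStandard (normalForm φ F) ∧ ∀ m, ∀ᶠ N in atTop,
      PowerSeries.coeff m ((reduce φ)^[N] F) = PowerSeries.coeff m (normalForm φ F) := by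
  have key : ∀ m, PowerSeries.coeff m (normalForm φ F) = (stabilizes φ hφ m F).choose := by
    intro m
    simp [normalForm, stabilizes φ hφ m F]
  refine ⟨fun m => ?_, fun m => ?_⟩
  · rw [key]
    exact (stabilizes φ hφ m F).choose_spec.1
  · rw [key]
    exact (stabilizes φ hφ m F).choose_spec.2

/-! ### Combinatorial star products -/

/-- The coefficient `B_n` of `t^n` of the combinatorial star product associated to `φ`, as a
bilinear map on polynomials. -/
def starCoeff (φ : Fin d → Fin d → PowerSeries (Pol d)) (n : ℕ) : Pol d →ₗ[ℂ] Pol d →ₗ[ℂ] Pol d :=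
  (MvPolynomial.basisMonomials (Fin d) ℂ).constr ℂ fun K =>
    (MvPolynomial.basisMonomials (Fin d) ℂ).constr ℂ fun L =>
      abelianize (PowerSeries.coeff n (normalForm φ (wordProduct K L)))

/-- The combinatorial star product associated to `φ`, i.e. the `ℂ⟦t⟧`-bilinear operation on
`ℂ[x_1, …, x_d]⟦t⟧` with `f ⋆ g = ∑ t^n B_n(f, g)` for polynomials `f`, `g`. -/
def starProd (φ : Fin d → Fin d → PowerSeries (Pol d)) (F G : PowerSeries (Pol d)) :
    PowerSeries (Pol d) :=
  PowerSeries.mk fun n =>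
    ∑ p ∈ Finset.HasAntidiagonal.antidiagonal n, ∑ q ∈ Finset.HasAntidiagonal.antidiagonal p.2,
      starCoeff φ p.1 (PowerSeries.coeff q.1 F) (PowerSeries.coeff q.2 G)

/-- The monomial `x^K`, as an element of `ℂ[x_1, …, x_d]⟦t⟧`. -/
def mon (K : Fin d →₀ ℕ) : PowerSeries (Pol d) := PowerSeries.C (MvPolynomial.monomial K 1)

/-- The formal power series in `t` that is the coefficient of `x^J` in `F`. -/
def coeffSeries (J : Fin d →₀ ℕ) (F : PowerSeries (Pol d)) : PowerSeries ℂ :=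
  PowerSeries.mk fun n => MvPolynomial.coeff J (PowerSeries.coeff n F)

/-! ### Poisson structures -/

/-- The bracket `∑ η_{ij} ∂_i f ∂_j g` of polynomials. -/
def polBracket (η : Fin d → Fin d → Pol d) (f g : Pol d) : Pol d :=
  ∑ i, ∑ j, η i j * MvPolynomial.pderiv i f * MvPolynomial.pderiv j g

/-- A polynomial Poisson structure on `ℝ^d`, given by its components `η_{ij} = {x_i, x_j}`. As
functions are complex-valued, the components may have complex coefficients; a real Poisson
structure is the case of real coefficients. -/
structure PoissonStructure (d : ℕ) where
  comp : Fin d → Fin d → Pol d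
  antisymm : ∀ i j, comp i j = -comp j i
  jacobi : ∀ f g h : Pol d, polBracket comp f (polBracket comp g h) +
    polBracket comp g (polBracket comp h f) + polBracket comp h (polBracket comp f g) = 0

/-- The complex-valued function on `ℝ^d` given by a polynomial. -/
def polFun (p : Pol d) (x : Fin d → ℝ) : ℂ := MvPolynomial.eval (fun i => (x i : ℂ)) p

/-- The partial derivative `∂_i f` of a complex-valued function on `ℝ^d`. -/
def partialDeriv (i : Fin d) (f : (Fin d → ℝ) → ℂ) (x : Fin d → ℝ) : ℂ :=
  fderiv ℝ f x (Pi.single i 1)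

/-- The Poisson bracket of (smooth) complex-valued functions on `ℝ^d`. -/
def PoissonStructure.bracket (η : PoissonStructure d) (f g : (Fin d → ℝ) → ℂ) (x : Fin d → ℝ) : ℂ :=
  ∑ i, ∑ j, polFun (η.comp i j) x * partialDeriv i f x * partialDeriv j g x

/-- The combinatorial star product associated to `φ` is a formal star product quantizing `η`. -/
structure Quantizes (φ : Fin d → Fin d → PowerSeries (Pol d)) (η : PoissonStructure d) : Prop where
  zeroth_order : ∀ f g : Pol d, starCoeff φ 0 f g = f * g
  assoc : ∀ F G H : PowerSeries (Pol d), starProd φ (starProd φ F G) H = starProd φ F (starProd φ G H)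
  first_order : ∀ f g : Pol d, starCoeff φ 1 f g - starCoeff φ 1 g f = Complex.I • polBracket η.comp f g
  one_star : ∀ F : PowerSeries (Pol d), starProd φ 1 F = F
  star_one : ∀ F : PowerSeries (Pol d), starProd φ F 1 = F

/-! ### Evaluation of the formal parameter -/

/-- `q` is holomorphic on the open set `Ω` and `c` is its power series expansion around `0`. -/
def IsExpansion (Ω : Set ℂ) (q : ℂ → ℂ) (c : PowerSeries ℂ) : Prop :=
  DifferentiableOn ℂ q Ω ∧ ∀ n, PowerSeries.coeff n c = iteratedDeriv n q 0 / (n.factorial : ℂ)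

/-- The bilinear maps `s ħ`, for `ħ ∈ Ω`, are obtained from the combinatorial star product by
evaluating `t` to `ħ`: the coefficients of `s ħ f g` are holomorphic functions of `ħ ∈ Ω` and their
power series expansions are the coefficients of `f ⋆ g`. -/
def IsEvaluation (Ω : Set ℂ) (φ : Fin d → Fin d → PowerSeries (Pol d))
    (s : ℂ → Pol d →ₗ[ℂ] Pol d →ₗ[ℂ] Pol d) : Prop :=
  ∀ (f g : Pol d) (J : Fin d →₀ ℕ), IsExpansion Ω (fun ħ => MvPolynomial.coeff J (s ħ f g))
    (coeffSeries J (starProd φ (PowerSeries.C f) (PowerSeries.C g)))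

/-! ### The MacGyver topology -/

/-- The norm `∑ |f_L| C^{|L|^2}`. -/
def macGyverNorm (C : Set.Ioi (0 : ℝ)) : Seminorm ℂ (Pol d) :=
  have key : ∀ (f : Pol d) (s : Finset (Fin d →₀ ℕ)), f.support ⊆ s →
      ∑ L ∈ f.support, ‖MvPolynomial.coeff L f‖ * (C : ℝ) ^ (L.degree ^ 2) =
        ∑ L ∈ s, ‖MvPolynomial.coeff L f‖ * (C : ℝ) ^ (L.degree ^ 2) := by
    intro f s hs
    refine Finset.sum_subset hs fun L _ hL => ?_
    simp [MvPolynomial.notMem_support_iff.1 hL]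
  Seminorm.of (fun f => ∑ L ∈ f.support, ‖MvPolynomial.coeff L f‖ * (C : ℝ) ^ (L.degree ^ 2))
    (by
      classical
      intro f g
      have hC : (0 : ℝ) < C := C.2
      rw [key (f + g) (f.support ∪ g.support) MvPolynomial.support_add,
        key f (f.support ∪ g.support) Finset.subset_union_left,
        key g (f.support ∪ g.support) Finset.subset_union_right, ← Finset.sum_add_distrib]
      refine Finset.sum_le_sum fun L _ => ?_
      rw [MvPolynomial.coeff_add, ← add_mul]
      exact mul_le_mul_of_nonneg_right (norm_add_le _ _) (by positivity))
    (by
      intro a f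
      rw [key (a • f) f.support MvPolynomial.support_smul, Finset.mul_sum]
      refine Finset.sum_congr rfl fun L _ => ?_
      rw [MvPolynomial.coeff_smul, norm_smul, mul_assoc])

/-- The MacGyver topology, as a uniform structure. -/
instance macGyverUniformSpace : UniformSpace (Pol d) :=
  ⨅ C, (macGyverNorm (d := d) C).toSeminormedAddCommGroup.toUniformSpace

instance : IsUniformAddGroup (Pol d) := isUniformAddGroup_iInf fun _ => inferInstance

lemma withSeminorms_macGyver : WithSeminorms (macGyverNorm (d := d)) :=
  (SeminormFamily.withSeminorms_iff_uniformSpace_eq_iInf _).2 rfl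

instance : ContinuousSMul ℂ (Pol d) := withSeminorms_macGyver.continuousSMul

instance : UniformContinuousConstSMul ℂ (Pol d) :=
  uniformContinuousConstSMul_of_continuousConstSMul ℂ (Pol d)

/-- The completion of the space of polynomial functions with respect to the MacGyver topology. -/
abbrev PolHat (d : ℕ) : Type := UniformSpace.Completion (Pol d)

/-- The bilinear map `b'` on the completion is a continuous extension of `b`. -/
def IsContExtension (b : Pol d →ₗ[ℂ] Pol d →ₗ[ℂ] Pol d)
    (b' : PolHat d →ₗ[ℂ] PolHat d →ₗ[ℂ] PolHat d) : Prop :=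
  (Continuous fun x : PolHat d × PolHat d => b' x.1 x.2) ∧
    ∀ f g : Pol d, b' (f : PolHat d) (g : PolHat d) = (b f g : PolHat d)

/-! ### Strict deformation quantizations -/

section Strict

variable {V : Type*} [AddCommGroup V] [Module ℂ V] [UniformSpace V]

/-- A map from an open set `Ω ⊆ ℂ` into a Fréchet space is holomorphic if its compositions with
continuous linear functionals are. -/
def IsHolomorphic (Ω : Set ℂ) (F : ℂ → V) : Prop :=
  ∀ ψ : V →L[ℂ] ℂ, DifferentiableOn ℂ (fun ħ => ψ (F ħ)) Ω

/-- The commutator quotient `(f ⋆_ħ g - g ⋆_ħ f) / (i ħ)`, with the value `{f, g}` at `ħ = 0`. -/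
def commQuotient (S : ℂ → V →ₗ[ℂ] V →ₗ[ℂ] V) (P : V →ₗ[ℂ] V →ₗ[ℂ] V) (f g : V) (ħ : ℂ) : V :=
  open Classical in
  if ħ = 0 then P f g else (1 / (Complex.I * ħ)) • (S ħ f g - S ħ g f)

variable (V) in
/-- Fréchet spaces: complete Hausdorff spaces with the topology of countably many seminorms. -/
structure IsFrechetSpace : Prop where
  uniformAddGroup : IsUniformAddGroup V
  t2 : T2Space V
  complete : CompleteSpace V
  seminorms : ∃ p : ℕ → Seminorm ℂ V, WithSeminorms p

/-- The Fréchet algebras `(V, S ħ)`, `ħ ∈ [0, ε)`, form a strict deformation quantization of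
`(ℝ^d, η)`, where `V` is viewed as a space of functions on `ℝ^d` via `ι`. -/
structure IsStrictQuantization (η : PoissonStructure d) (ε : ℝ) (ι : V →ₗ[ℂ] ((Fin d → ℝ) → ℂ))
    (S : ℝ → V →ₗ[ℂ] V →ₗ[ℂ] V) : Prop where
  pos : 0 < ε
  frechet : IsFrechetSpace V
  assoc : ∀ ħ ∈ Set.Ico 0 ε, ∀ f g h : V, S ħ (S ħ f g) h = S ħ f (S ħ g h)
  continuous : ∀ ħ ∈ Set.Ico 0 ε, Continuous fun x : V × V => S ħ x.1 x.2
  injective : Function.Injective ι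
  pol_mem : ∀ p : Pol d, ∃ f : V, ι f = polFun p
  smooth : ∀ f : V, ContDiff ℝ (⊤ : ℕ∞) (ι f)
  mul_zero : ∀ f g : V, ι (S 0 f g) = ι f * ι g
  bracket_mem : ∀ f g : V, ∃ h : V, ι h = η.bracket (ι f) (ι g)
  continuousOn : ∀ f g : V, ContinuousOn (fun ħ => S ħ f g) (Set.Ico 0 ε)
  limit : ∀ f g h : V, ι h = η.bracket (ι f) (ι g) →
    Tendsto (fun ħ : ℝ => (1 / (Complex.I * ħ)) • (S ħ f g - S ħ g f)) (𝓝[>] 0) (𝓝 h)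

end Strict

end CombStar

end

open CombStar

/-!
The theorem rests on one estimate: for each MacGyver norm and each compact subset of `Ω`, the
evaluated products `x^K ⋆_ħ x^L` are bounded by a product of MacGyver norms of `x^K` and `x^L`,
uniformly in `ħ` (`exists_evaluation`).

By hypothesis (a) the rules `φ (x_j x_i) = x_j ⋆ x_i - x_i x_j` depend holomorphically on the
parameter. Hence so do the iterated reductions of a word, and a single reduction multiplies the
`ℓ¹`-norm of the coefficients by at most a factor that is bounded on compact sets
(`exists_iterate_family`). With `N = |K| + |L|`, hypothesis (b) bounds the `ℓ¹`-norm of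
`x^K ⋆_ħ x^L` by `A ^ (α N²)`, and hypothesis (c) bounds its degree by `β N`, so that its MacGyver
norms are at most `B ^ N²` for some `B`. As `N² ≤ 2 |K|² + 2 |L|²`, this is dominated by
`(B²) ^ |K|² (B²) ^ |L|²`, a product of two values of a MacGyver norm.

Uniqueness and associativity of the evaluated products are instances of the identity theorem, since
both sides are holomorphic with the same expansion at `0` (`IsExpansion.eqOn`, `IsStarFamily.star`).
Cauchy's estimates, applied after a functional which norms a given polynomial
(`exists_functional_eq_pnorm`), transfer the bound to the `B_n` and to the remainders of the
expansion in `ħ` (`IsStarFamily.pnorm_starCoeff_le`, `IsStarFamily.pnorm_sub_sum_le`). All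
these bounds persist on the completion by density. They give the power series
expansion on discs, holomorphy as a locally uniform limit of the polynomial case
(`tendstoLocallyUniformlyOn_star`), and the classical limit of the commutators from the second order
remainder (`tendsto_commutator`); the commutator quotient is then a divided difference of a
holomorphic function, which is holomorphic by the removable singularity theorem.

Elements of the completion are smooth functions, because evaluations and partial derivatives are
continuous for the MacGyver topology, locally uniformly in the point (`hasFDerivAt_toFun`). The
map to functions is injective: an element of the completion is determined by its coefficients, and
these are derivatives at `0` up to factorials (`toFun_injective`).
-/

noncomputable section

namespace CombStar

variable {d : ℕ} {Ω : Set ℂ}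

/-! ### Holomorphic functions and their expansions -/

lemma IsExpansion.contDiffAt {q : ℂ → ℂ} {c : PowerSeries ℂ} (h : IsExpansion Ω q c)
    (hΩ : IsOpen Ω) (h0 : (0 : ℂ) ∈ Ω) (n : ℕ) : ContDiffAt ℂ n q 0 :=
  (h.1.analyticAt (hΩ.mem_nhds h0)).contDiffAt

lemma isExpansion_const (a : ℂ) : IsExpansion Ω (fun _ => a) (PowerSeries.C a) := by
  refine ⟨differentiableOn_const a, fun n => ?_⟩
  rw [PowerSeries.coeff_C, iteratedDeriv_const]
  split_ifs with h <;> simp [h]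

lemma IsExpansion.add {q q' : ℂ → ℂ} {c c' : PowerSeries ℂ} (h : IsExpansion Ω q c)
    (h' : IsExpansion Ω q' c') (hΩ : IsOpen Ω) (h0 : (0 : ℂ) ∈ Ω) :
    IsExpansion Ω (fun ħ => q ħ + q' ħ) (c + c') := by
  refine ⟨h.1.add h'.1, fun n => ?_⟩
  rw [iteratedDeriv_fun_add (h.contDiffAt hΩ h0 n) (h'.contDiffAt hΩ h0 n), map_add, h.2, h'.2,
    add_div]

lemma IsExpansion.mul {q q' : ℂ → ℂ} {c c' : PowerSeries ℂ} (h : IsExpansion Ω q c)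
    (h' : IsExpansion Ω q' c') (hΩ : IsOpen Ω) (h0 : (0 : ℂ) ∈ Ω) :
    IsExpansion Ω (fun ħ => q ħ * q' ħ) (c * c') := by
  refine ⟨h.1.mul h'.1, fun n => ?_⟩
  rw [iteratedDeriv_fun_mul (h.contDiffAt hΩ h0 n) (h'.contDiffAt hΩ h0 n), PowerSeries.coeff_mul,
    Finset.Nat.sum_antidiagonal_eq_sum_range_succ
      (fun i j => PowerSeries.coeff i c * PowerSeries.coeff j c'), Finset.sum_div]
  refine Finset.sum_congr rfl fun i hi => ?_
  have hi' : i ≤ n := Nat.lt_succ_iff.1 (Finset.mem_range.1 hi)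
  have hn : (n.factorial : ℂ) = n.choose i * i.factorial * (n - i).factorial := by
    exact_mod_cast (Nat.choose_mul_factorial_mul_factorial hi').symm
  have h1 : (i.factorial : ℂ) ≠ 0 := by exact_mod_cast i.factorial_ne_zero
  have h2 : ((n - i).factorial : ℂ) ≠ 0 := by exact_mod_cast (n - i).factorial_ne_zero
  have h3 : (n.choose i : ℂ) ≠ 0 := by exact_mod_cast (Nat.choose_pos hi').ne'
  rw [h.2, h'.2, hn]
  field_simp

lemma IsExpansion.hasSum {q : ℂ → ℂ} {c : PowerSeries ℂ} (h : IsExpansion Ω q c) {r : ℝ}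
    (hr : Metric.ball 0 r ⊆ Ω) {ħ : ℂ} (hħ : ħ ∈ Metric.ball 0 r) :
    HasSum (fun n => ħ ^ n * PowerSeries.coeff n c) (q ħ) := by
  have := Complex.hasSum_taylorSeries_on_ball (h.1.mono hr) hħ
  have e : (fun n : ℕ => ħ ^ n * PowerSeries.coeff n c) =
      fun n : ℕ => (n.factorial : ℂ)⁻¹ • (ħ - 0) ^ n • iteratedDeriv n q 0 := by
    funext n
    rw [h.2, sub_zero, smul_eq_mul, smul_eq_mul]
    ring
  rw [e]
  exact this

/-- A holomorphic function on a connected domain is determined by its expansion. -/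
lemma IsExpansion.eqOn {q q' : ℂ → ℂ} {c : PowerSeries ℂ} (h : IsExpansion Ω q c)
    (h' : IsExpansion Ω q' c) (hΩ : IsOpen Ω) (hΩc : IsConnected Ω) (h0 : (0 : ℂ) ∈ Ω) :
    Set.EqOn q q' Ω := by
  obtain ⟨r, hr, hrΩ⟩ := Metric.isOpen_iff.1 hΩ 0 h0
  refine (h.1.analyticOnNhd hΩ).eqOn_of_preconnected_of_eventuallyEq (h'.1.analyticOnNhd hΩ)
    hΩc.isPreconnected h0 ?_
  filter_upwards [Metric.ball_mem_nhds 0 hr] with ħ hħ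
  exact (h.hasSum hrΩ hħ).unique (h'.hasSum hrΩ hħ)

/-- Cauchy's estimate for the coefficients of the expansion. -/
lemma IsExpansion.norm_coeff_le {q : ℂ → ℂ} {c : PowerSeries ℂ} (h : IsExpansion Ω q c) {ρ M : ℝ}
    (hρ : 0 < ρ) (hρΩ : Metric.closedBall 0 ρ ⊆ Ω) (hM : ∀ ħ ∈ Metric.closedBall 0 ρ, ‖q ħ‖ ≤ M)
    (n : ℕ) : ‖PowerSeries.coeff n c‖ ≤ M / ρ ^ n := by
  have hd : DiffContOnCl ℂ q (Metric.ball 0 ρ) := by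
    refine DifferentiableOn.diffContOnCl ?_
    rw [closure_ball _ hρ.ne']
    exact h.1.mono hρΩ
  have := Complex.norm_iteratedDeriv_le_of_forall_mem_sphere_norm_le n hρ hd
    fun z hz => hM z (Metric.sphere_subset_closedBall hz)
  have hn : (0 : ℝ) < n.factorial := by exact_mod_cast n.factorial_pos
  rw [h.2, norm_div, Complex.norm_natCast, div_le_iff₀ hn]
  calc _ ≤ _ := this
    _ = _ := by ring

/-- The tail `∑_{k ∉ s} θ ^ k` of the geometric series. -/
def geomTail (θ : ℝ) (s : Finset ℕ) : ℝ := (1 - θ)⁻¹ - ∑ k ∈ s, θ ^ k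

lemma geomTail_mono {θ θ' : ℝ} (h0 : 0 ≤ θ) (h : θ ≤ θ') (h1 : θ' < 1) (s : Finset ℕ) :
    geomTail θ s ≤ geomTail θ' s := by
  have e : ∀ x : ℝ, 0 ≤ x → x < 1 →
      HasSum (fun k : {x // x ∉ s} => x ^ (k : ℕ)) (geomTail x s) := by
    intro x hx hx1
    refine (s.hasSum_compl_iff (f := fun k : ℕ => x ^ k)).2 ?_
    simpa [geomTail] using hasSum_geometric_of_lt_one hx hx1
  exact hasSum_le (fun k => pow_le_pow_left₀ h0 h _) (e θ h0 (h.trans_lt h1))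
    (e θ' (h0.trans h) h1)

lemma tendsto_geomTail {θ : ℝ} (h0 : 0 ≤ θ) (h1 : θ < 1) :
    Tendsto (geomTail θ) atTop (𝓝 0) := by
  have := (hasSum_geometric_of_lt_one h0 h1)
  simpa [geomTail] using! (tendsto_const_nhds (x := (1 - θ)⁻¹)).sub this

/-- The remainders of the expansion are dominated by those of a geometric series. -/
lemma IsExpansion.norm_sub_sum_le {q : ℂ → ℂ} {c : PowerSeries ℂ} (h : IsExpansion Ω q c)
    {ρ M : ℝ} (hρ : 0 < ρ) (hρΩ : Metric.closedBall 0 ρ ⊆ Ω)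
    (hM : ∀ ħ ∈ Metric.closedBall 0 ρ, ‖q ħ‖ ≤ M) {ħ : ℂ} (hħ : ‖ħ‖ < ρ) (s : Finset ℕ) :
    ‖q ħ - ∑ k ∈ s, ħ ^ k * PowerSeries.coeff k c‖ ≤ M * geomTail (‖ħ‖ / ρ) s := by
  have hθ : ‖ħ‖ / ρ < 1 := (div_lt_one hρ).2 hħ
  have hsum := (h.hasSum (Metric.ball_subset_closedBall.trans hρΩ) (ħ := ħ) (by simpa using hħ))
  have hg := (hasSum_geometric_of_lt_one (div_nonneg (norm_nonneg ħ) hρ.le) hθ).mul_left M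
  have hs : HasSum (fun k : {x // x ∉ s} => ħ ^ (k : ℕ) * PowerSeries.coeff (k : ℕ) c)
      (q ħ - ∑ k ∈ s, ħ ^ k * PowerSeries.coeff k c) := by
    refine (s.hasSum_compl_iff (f := fun k : ℕ => ħ ^ k * PowerSeries.coeff k c)).2 ?_
    simpa using hsum
  have hs' : HasSum (fun k : {x // x ∉ s} => M * (‖ħ‖ / ρ) ^ (k : ℕ))
      (M * geomTail (‖ħ‖ / ρ) s) := by
    refine (s.hasSum_compl_iff (f := fun k : ℕ => M * (‖ħ‖ / ρ) ^ k)).2 ?_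
    have e : M * geomTail (‖ħ‖ / ρ) s + ∑ k ∈ s, M * (‖ħ‖ / ρ) ^ k = M * (1 - ‖ħ‖ / ρ)⁻¹ := by
      rw [geomTail, ← Finset.mul_sum]
      ring
    rw [e]
    exact hg
  rw [← hs.tsum_eq]
  refine tsum_of_norm_bounded hs' fun k => ?_
  rw [norm_mul, norm_pow]
  calc _ ≤ ‖ħ‖ ^ (k : ℕ) * (M / ρ ^ (k : ℕ)) := by
        gcongr
        exact h.norm_coeff_le hρ hρΩ hM k
    _ = _ := by rw [div_pow]; ring

/-! ### Holomorphic families and formal power series -/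

/-- A holomorphic family `F` of elements of `A` with expansion `f`: a finite sum of terms `a ħ • v`
with `a` holomorphic on `Ω`, together with the corresponding formal power series. -/
inductive IsFamily (Ω : Set ℂ) {A : Type*} [Ring A] [Algebra ℂ A] :
    (ℂ → A) → PowerSeries A → Prop
  | smul {a : ℂ → ℂ} {c : PowerSeries ℂ} (v : A) (h : IsExpansion Ω a c) :
      IsFamily Ω (fun ħ => a ħ • v) (PowerSeries.mk fun n => PowerSeries.coeff n c • v)
  | add {F G : ℂ → A} {f g : PowerSeries A} (hF : IsFamily Ω F f) (hG : IsFamily Ω G g) :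
      IsFamily Ω (fun ħ => F ħ + G ħ) (f + g)

namespace IsFamily

variable {A B : Type*} [Ring A] [Algebra ℂ A] [Ring B] [Algebra ℂ B]

lemma congr {F G : ℂ → A} {f g : PowerSeries A} (h : IsFamily Ω F f) (hF : ∀ ħ, F ħ = G ħ)
    (hf : ∀ n, PowerSeries.coeff n f = PowerSeries.coeff n g) : IsFamily Ω G g := by
  have h1 : F = G := funext hF
  have h2 : f = g := PowerSeries.ext hf
  rwa [← h1, ← h2]

lemma const (v : A) : IsFamily Ω (fun _ => v) (PowerSeries.C v) :=
  (IsFamily.smul v (isExpansion_const 1)).congr (by simp) fun n => by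
    rw [PowerSeries.coeff_mk, PowerSeries.coeff_C, PowerSeries.coeff_C]
    split_ifs <;> simp

lemma smul_const (z : ℂ) {F : ℂ → A} {f : PowerSeries A} (h : IsFamily Ω F f) (hΩ : IsOpen Ω)
    (h0 : (0 : ℂ) ∈ Ω) : IsFamily Ω (fun ħ => z • F ħ) (z • f) := by
  induction h with
  | smul v h =>
    refine (IsFamily.smul v ((isExpansion_const z).mul h hΩ h0)).congr (by simp [mul_smul]) ?_
    intro n
    simp [PowerSeries.coeff_C_mul, mul_smul]
  | add _ _ h1 h2 => exact (h1.add h2).congr (by simp) (by simp)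

lemma sum {ι : Type*} (s : Finset ι) {F : ι → ℂ → A} {f : ι → PowerSeries A}
    (h : ∀ i ∈ s, IsFamily Ω (F i) (f i)) :
    IsFamily Ω (fun ħ => ∑ i ∈ s, F i ħ) (∑ i ∈ s, f i) := by
  classical
  induction s using Finset.induction_on with
  | empty => exact (const (0 : A)).congr (by simp) (by simp)
  | insert i s hi ih =>
    exact ((h i (by simp)).add (ih fun j hj => h j (by simp [hj]))).congr
      (by simp [Finset.sum_insert hi]) (by simp [Finset.sum_insert hi])

lemma map (T : A →ₗ[ℂ] B) {F : ℂ → A} {f : PowerSeries A} (h : IsFamily Ω F f) :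
    IsFamily Ω (fun ħ => T (F ħ)) (PowerSeries.mk fun n => T (PowerSeries.coeff n f)) := by
  induction h with
  | smul v h => exact (IsFamily.smul (T v) h).congr (by simp) (by simp)
  | add _ _ h1 h2 => exact (h1.add h2).congr (by simp) (by simp)

lemma mul_const (v : A) {F : ℂ → A} {f : PowerSeries A} (h : IsFamily Ω F f) :
    IsFamily Ω (fun ħ => F ħ * v) (f * PowerSeries.C v) :=
  (h.map (LinearMap.mulRight ℂ v)).congr (by simp) (by simp)

lemma const_mul (v : A) {F : ℂ → A} {f : PowerSeries A} (h : IsFamily Ω F f) :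
    IsFamily Ω (fun ħ => v * F ħ) (PowerSeries.C v * f) :=
  (h.map (LinearMap.mulLeft ℂ v)).congr (by simp) (by simp)

lemma functional (ℓ : A →ₗ[ℂ] ℂ) {F : ℂ → A} {f : PowerSeries A} (h : IsFamily Ω F f)
    (hΩ : IsOpen Ω) (h0 : (0 : ℂ) ∈ Ω) :
    IsExpansion Ω (fun ħ => ℓ (F ħ)) (PowerSeries.mk fun n => ℓ (PowerSeries.coeff n f)) := by
  induction h with
  | @smul a c v h =>
    have := h.mul (isExpansion_const (ℓ v)) hΩ h0
    refine ⟨this.1.congr (by simp), fun n => ?_⟩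
    simpa [PowerSeries.coeff_mul_C] using! this.2 n
  | add _ _ h1 h2 =>
    have := h1.add h2 hΩ h0
    refine ⟨this.1.congr (by simp), fun n => ?_⟩
    simpa using! this.2 n

lemma exists_bound (p : Seminorm ℂ A) {F : ℂ → A} {f : PowerSeries A} (h : IsFamily Ω F f)
    {K : Set ℂ} (hK : IsCompact K) (hKΩ : K ⊆ Ω) : ∃ M : ℝ, ∀ ħ ∈ K, p (F ħ) ≤ M := by
  induction h with
  | @smul a c v h =>
    obtain ⟨M, hM⟩ := hK.exists_bound_of_continuousOn (h.1.continuousOn.mono hKΩ)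
    refine ⟨M * p v, fun ħ hħ => ?_⟩
    rw [map_smul_eq_mul]
    exact mul_le_mul_of_nonneg_right (hM ħ hħ) (apply_nonneg p v)
  | add _ _ h1 h2 =>
    obtain ⟨M, hM⟩ := h1
    obtain ⟨M', hM'⟩ := h2
    exact ⟨M + M', fun ħ hħ => (map_add_le_add p _ _).trans (add_le_add (hM ħ hħ) (hM' ħ hħ))⟩

/-- Multiplication by a scalar holomorphic function. -/
lemma expansion_smul {a : ℂ → ℂ} {c : PowerSeries ℂ} (ha : IsExpansion Ω a c) {F : ℂ → A}
    {f : PowerSeries A} (h : IsFamily Ω F f) (hΩ : IsOpen Ω) (h0 : (0 : ℂ) ∈ Ω) :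
    IsFamily Ω (fun ħ => a ħ • F ħ) (PowerSeries.mk fun n =>
      ∑ p ∈ Finset.HasAntidiagonal.antidiagonal n,
        PowerSeries.coeff p.1 c • PowerSeries.coeff p.2 f) := by
  induction h with
  | smul v h =>
    refine (IsFamily.smul v (ha.mul h hΩ h0)).congr (by simp [mul_smul]) ?_
    intro n
    simp [PowerSeries.coeff_mul, Finset.sum_smul, mul_smul]
  | add _ _ h1 h2 =>
    exact (h1.add h2).congr (by simp) (by simp [Finset.sum_add_distrib])

end IsFamily

/-! ### The `ℓ¹`-norm on the free algebra -/

/-- The sum of the absolute values of the coefficients of an element of the free algebra. -/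
def wordNorm : Seminorm ℂ (FreeAlg d) :=
  have key : ∀ (x : FreeAlg d) (s : Finset (FreeMonoid (Fin d))), x.coeff.support ⊆ s →
      ∑ w ∈ x.coeff.support, ‖x.coeff w‖ = ∑ w ∈ s, ‖x.coeff w‖ := by
    intro x s hs
    refine Finset.sum_subset hs fun w _ hw => ?_
    simp [Finsupp.notMem_support_iff.1 hw]
  Seminorm.of (fun x => ∑ w ∈ x.coeff.support, ‖x.coeff w‖)
    (by
      classical
      intro x y
      rw [key (x + y) (x.coeff.support ∪ y.coeff.support) Finsupp.support_add,
        key x (x.coeff.support ∪ y.coeff.support) Finset.subset_union_left,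
        key y (x.coeff.support ∪ y.coeff.support) Finset.subset_union_right,
        ← Finset.sum_add_distrib]
      exact Finset.sum_le_sum fun w _ => norm_add_le _ _)
    (by
      intro a x
      rw [key (a • x) x.coeff.support Finsupp.support_smul, Finset.mul_sum]
      refine Finset.sum_congr rfl fun w _ => ?_
      rw [MonoidAlgebra.coeff_smul, Finsupp.smul_apply, norm_smul])

lemma wordNorm_apply (x : FreeAlg d) :
    wordNorm x = ∑ w ∈ x.coeff.support, ‖x.coeff w‖ := rfl

@[simp] lemma wordNorm_word (w : List (Fin d)) : wordNorm (word w) = 1 := by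
  rw [wordNorm_apply]
  simp [word]

lemma eq_sum_words (x : FreeAlg d) :
    x = ∑ w ∈ x.coeff.support, x.coeff w • word w.toList := by
  apply (MonoidAlgebra.coeffLinearEquiv ℂ).injective
  rw [map_sum]
  conv_lhs => rw [show MonoidAlgebra.coeffLinearEquiv ℂ x = x.coeff from rfl,
    ← Finsupp.sum_single x.coeff]
  refine Finset.sum_congr rfl fun w _ => ?_
  rw [map_smul]
  simp [word, MonoidAlgebra.coeffLinearEquiv]

lemma seminorm_map_le_wordNorm {V : Type*} [AddCommGroup V] [Module ℂ V] (p : Seminorm ℂ V)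
    (T : FreeAlg d →ₗ[ℂ] V) {M : ℝ} (h : ∀ w, p (T (word w)) ≤ M) (x : FreeAlg d) :
    p (T x) ≤ M * wordNorm x := by
  conv_lhs => rw [eq_sum_words x, map_sum]
  rw [wordNorm_apply, Finset.mul_sum]
  refine (Finset.le_sum_of_subadditive p (map_zero p).le (map_add_le_add p) _ _).trans
    (Finset.sum_le_sum fun w _ => ?_)
  rw [map_smul, map_smul_eq_mul, mul_comm]
  exact mul_le_mul_of_nonneg_right (h _) (norm_nonneg _)

lemma wordNorm_word_mul_le (u : List (Fin d)) (x : FreeAlg d) :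
    wordNorm (word u * x) ≤ wordNorm x := by
  simpa using seminorm_map_le_wordNorm wordNorm (LinearMap.mulLeft ℂ (word u)) (M := 1)
    (fun w => by simp [← word_append]) x

lemma wordNorm_mul_word_le (x : FreeAlg d) (u : List (Fin d)) :
    wordNorm (x * word u) ≤ wordNorm x := by
  simpa using seminorm_map_le_wordNorm wordNorm (LinearMap.mulRight ℂ (word u)) (M := 1)
    (fun w => by simp [← word_append]) x

/-- The linear map on the free algebra with given values on words. -/
def wordLift {V : Type*} [AddCommGroup V] [Module ℂ V] (R : List (Fin d) → V) :
    FreeAlg d →ₗ[ℂ] V :=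
  Finsupp.linearCombination ℂ (fun w : FreeMonoid (Fin d) => R w.toList) ∘ₗ
    (MonoidAlgebra.coeffLinearEquiv ℂ).toLinearMap

lemma wordLift_word {V : Type*} [AddCommGroup V] [Module ℂ V] (R : List (Fin d) → V)
    (w : List (Fin d)) : wordLift R (word w) = R w := by
  simp [wordLift, word, MonoidAlgebra.coeffLinearEquiv]

/-! ### Reductions depending holomorphically on the parameter -/

section Reduction

variable {φ : Fin d → Fin d → PowerSeries (Pol d)} {Φ : Fin d → Fin d → ℂ → Pol d}

/-- A bound for the `ℓ¹`-norm of one reduction of a word at the parameter value `ħ`. -/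
def reductionBound (Φ : Fin d → Fin d → ℂ → Pol d) (ħ : ℂ) : ℝ :=
  1 + ∑ a, ∑ b ∈ Finset.univ.filter (· < a), wordNorm (stdLift (Φ a b ħ))

lemma add_le_reductionBound {a b : Fin d} (h : b < a) (ħ : ℂ) :
    1 + wordNorm (stdLift (Φ a b ħ)) ≤ reductionBound Φ ħ := by
  unfold reductionBound
  gcongr
  have hb : b ∈ Finset.univ.filter (· < a) := Finset.mem_filter.2 ⟨Finset.mem_univ b, h⟩
  refine (Finset.single_le_sum (f := fun b => wordNorm (stdLift (Φ a b ħ)))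
    (fun _ _ => apply_nonneg _ _) hb).trans ?_
  exact Finset.single_le_sum (f := fun a => ∑ b ∈ Finset.univ.filter (· < a),
    wordNorm (stdLift (Φ a b ħ))) (fun _ _ => Finset.sum_nonneg fun _ _ => apply_nonneg _ _)
    (Finset.mem_univ a)

lemma one_le_reductionBound (ħ : ℂ) : 1 ≤ reductionBound Φ ħ :=
  le_add_of_nonneg_right
    (Finset.sum_nonneg fun _ _ => Finset.sum_nonneg fun _ _ => apply_nonneg _ _)

lemma exists_reductionBound_le (hΦ : ∀ a b, b < a → IsFamily Ω (Φ a b) (φ a b)) {K : Set ℂ}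
    (hK : IsCompact K) (hKΩ : K ⊆ Ω) : ∃ M : ℝ, ∀ ħ ∈ K, reductionBound Φ ħ ≤ M := by
  have : ∀ a b, ∃ M : ℝ, b < a → ∀ ħ ∈ K, wordNorm (stdLift (Φ a b ħ)) ≤ M := by
    intro a b
    by_cases h : b < a
    · obtain ⟨M, hM⟩ := ((hΦ a b h).map stdLift).exists_bound wordNorm hK hKΩ
      exact ⟨M, fun _ => hM⟩
    · exact ⟨0, fun h' => absurd h' h⟩
  choose M hM using this
  refine ⟨1 + ∑ a, ∑ b ∈ Finset.univ.filter (· < a), M a b, fun ħ hħ => ?_⟩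
  unfold reductionBound
  gcongr with a _ b hb
  exact hM a b (Finset.mem_filter.1 hb).2 ħ hħ

/-- One reduction of a word is a holomorphic family, with an `ℓ¹`-bound that does not depend on the
word. -/
lemma exists_reduceWord_family (hΦ : ∀ a b, b < a → IsFamily Ω (Φ a b) (φ a b)) :
    ∀ w : List (Fin d), ∃ F : ℂ → FreeAlg d, IsFamily Ω F (reduceWord φ w) ∧
      ∀ ħ, wordNorm (F ħ) ≤ reductionBound Φ ħ
  | [] => ⟨fun _ => word [], by
      rw [reduceWord, ← map_one PowerSeries.C, ← word_nil]
      exact IsFamily.const _, fun ħ => by simpa using one_le_reductionBound ħ⟩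
  | [a] => ⟨fun _ => word [a], IsFamily.const _, fun ħ => by simpa using one_le_reductionBound ħ⟩
  | a :: b :: v => by
    rw [reduceWord]
    split_ifs with h1 h2
    · refine ⟨_, (((IsFamily.const (word [b, a])).add ((hΦ a b h2).map stdLift)).mul_const
        (word v)), fun ħ => ?_⟩
      refine (wordNorm_mul_word_le _ _).trans ((map_add_le_add _ _ _).trans ?_)
      rw [wordNorm_word]
      exact add_le_reductionBound h2 ħ
    · exact ⟨_, IsFamily.const _, fun ħ => by simpa using one_le_reductionBound ħ⟩
    · obtain ⟨F, hF, hn⟩ := exists_reduceWord_family hΦ (b :: v)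
      exact ⟨_, hF.const_mul (word [a]), fun ħ => (wordNorm_word_mul_le _ _).trans (hn ħ)⟩

/-- If the reductions of words form holomorphic families, so do the reductions of a holomorphic
family. -/
lemma IsFamily.reduce {R : List (Fin d) → ℂ → FreeAlg d}
    (hR : ∀ w, IsFamily Ω (R w) (reduceWord φ w)) (hΩ : IsOpen Ω) (h0 : (0 : ℂ) ∈ Ω)
    {F : ℂ → FreeAlg d} {f : PowerSeries (FreeAlg d)} (h : IsFamily Ω F f) :
    IsFamily Ω (fun ħ => wordLift (fun w => R w ħ) (F ħ)) (CombStar.reduce φ f) := by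
  induction h with
  | @smul a c v h =>
    have hv : IsFamily Ω (fun ħ => wordLift (fun w => R w ħ) v)
        (PowerSeries.mk fun n => reduceCoeff φ n v) := by
      refine (IsFamily.sum v.coeff.support fun w _ =>
        (hR w.toList).smul_const (v.coeff w) hΩ h0).congr (fun ħ => rfl) fun n => ?_
      rw [map_sum, PowerSeries.coeff_mk]
      exact Finset.sum_congr rfl fun w _ => by simp
    refine (hv.expansion_smul h hΩ h0).congr (fun ħ => by simp) fun n => ?_
    rw [coeff_reduce, PowerSeries.coeff_mk]
    exact Finset.sum_congr rfl fun w _ => by simp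
  | add _ _ h1 h2 =>
    rw [reduce_add]
    exact (h1.add h2).congr (by simp) fun _ => rfl

/-- Since one reduction multiplies the `ℓ¹`-norm at most by a locally bounded factor, `N`
reductions do so at most by its `N`-th power. -/
lemma exists_iterate_family (hΦ : ∀ a b, b < a → IsFamily Ω (Φ a b) (φ a b)) (hΩ : IsOpen Ω)
    (h0 : (0 : ℂ) ∈ Ω) (w : List (Fin d)) (N : ℕ) :
    ∃ F : ℂ → FreeAlg d, IsFamily Ω F ((reduce φ)^[N] (PowerSeries.C (word w))) ∧
      ∀ ħ, wordNorm (F ħ) ≤ reductionBound Φ ħ ^ N := by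
  choose R hR hRn using exists_reduceWord_family hΦ
  induction N with
  | zero => exact ⟨_, IsFamily.const _, by simp⟩
  | succ N ih =>
    obtain ⟨F, hF, hn⟩ := ih
    rw [Function.iterate_succ_apply']
    refine ⟨_, hF.reduce hR hΩ h0, fun ħ => ?_⟩
    rw [pow_succ']
    refine (seminorm_map_le_wordNorm wordNorm _ (fun w => ?_) (F ħ)).trans
      (mul_le_mul_of_nonneg_left (hn ħ) (zero_le_one.trans (one_le_reductionBound ħ)))
    rw [wordLift_word]
    exact hRn w ħ

end Reduction

/-! ### Normal forms -/

section NormalForm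

variable {φ : Fin d → Fin d → PowerSeries (Pol d)}

lemma reduce_of_isStandard {F : PowerSeries (FreeAlg d)} (h : IsStandard F) : reduce φ F = F := by
  have key : ∀ n m, reduceCoeff φ n (PowerSeries.coeff m F) =
      if n = 0 then PowerSeries.coeff m F else 0 := by
    intro n m
    conv_rhs => rw [eq_sum_words (PowerSeries.coeff m F)]
    rw [show reduceCoeff φ n (PowerSeries.coeff m F) = ∑ w ∈ (PowerSeries.coeff m F).coeff.support,
      (PowerSeries.coeff m F).coeff w • PowerSeries.coeff n (reduceWord φ w.toList) from rfl]
    split_ifs with hn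
    · refine Finset.sum_congr rfl fun w hw => ?_
      rw [reduceWord_std φ _ (h m w hw), PowerSeries.coeff_C, if_pos hn]
    · refine Finset.sum_eq_zero fun w hw => ?_
      rw [reduceWord_std φ _ (h m w hw), PowerSeries.coeff_C, if_neg hn, smul_zero]
  ext1 n
  rw [coeff_reduce, Finset.sum_eq_single (n, 0)]
  · simp [key]
  · rintro ⟨a, b⟩ hab hne
    have hb : b ≠ 0 := by
      rintro rfl
      simp at hab
      exact hne (by simp [hab])
    simp [key, hb]
  · simp

lemma normalForm_eq (hφ : ∀ i j, i < j → PowerSeries.constantCoeff (φ j i) = 0)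
    {F : PowerSeries (FreeAlg d)} {N : ℕ} (h : IsStandard ((reduce φ)^[N] F)) :
    normalForm φ F = (reduce φ)^[N] F := by
  ext1 m
  obtain ⟨n, hn, hN⟩ := (((normalForm_spec φ hφ F).2 m).and (eventually_ge_atTop N)).exists
  obtain ⟨k, rfl⟩ := Nat.exists_eq_add_of_le' hN
  rw [← hn, Function.iterate_add_apply, Function.iterate_fixed (reduce_of_isStandard h)]

end NormalForm

/-! ### The MacGyver norms with integral parameter -/

/-- The MacGyver norm with parameter `C = n + 1`. These norms increase with `n` and define the
MacGyver topology. -/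
def pnorm (n : ℕ) : Seminorm ℂ (Pol d) :=
  macGyverNorm ⟨n + 1, by simp only [Set.mem_Ioi]; positivity⟩

lemma pnorm_apply (n : ℕ) (f : Pol d) :
    pnorm n f = ∑ L ∈ f.support, ‖MvPolynomial.coeff L f‖ * ((n : ℝ) + 1) ^ (L.degree ^ 2) := rfl

@[simp] lemma pnorm_monomial (n : ℕ) (K : Fin d →₀ ℕ) :
    pnorm n (MvPolynomial.monomial K (1 : ℂ)) = ((n : ℝ) + 1) ^ (K.degree ^ 2) := by
  rw [pnorm_apply, MvPolynomial.support_monomial, if_neg one_ne_zero]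
  simp

lemma pnorm_mono {m n : ℕ} (h : m ≤ n) (f : Pol d) : pnorm m f ≤ pnorm n f := by
  rw [pnorm_apply, pnorm_apply]
  gcongr

lemma eq_sum_monomials (f : Pol d) :
    f = ∑ K ∈ f.support, MvPolynomial.coeff K f • MvPolynomial.monomial K (1 : ℂ) := by
  conv_lhs => rw [f.as_sum]
  simp [MvPolynomial.smul_monomial]

lemma seminorm_map_le_pnorm {V : Type*} [AddCommGroup V] [Module ℂ V] (p : Seminorm ℂ V)
    (T : Pol d →ₗ[ℂ] V) {M : ℝ} {n : ℕ}
    (h : ∀ K, p (T (MvPolynomial.monomial K 1)) ≤ M * pnorm n (MvPolynomial.monomial K (1 : ℂ)))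
    (f : Pol d) : p (T f) ≤ M * pnorm n f := by
  conv_lhs => rw [eq_sum_monomials f, map_sum]
  rw [pnorm_apply, Finset.mul_sum]
  refine (Finset.le_sum_of_subadditive p (map_zero p).le (map_add_le_add p) _ _).trans
    (Finset.sum_le_sum fun K _ => ?_)
  rw [map_smul, map_smul_eq_mul, mul_left_comm, ← pnorm_monomial]
  exact mul_le_mul_of_nonneg_left (h K) (norm_nonneg _)

lemma seminorm_map₂_le_pnorm {V : Type*} [AddCommGroup V] [Module ℂ V] (p : Seminorm ℂ V)
    (b : Pol d →ₗ[ℂ] Pol d →ₗ[ℂ] V) {n : ℕ}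
    (h : ∀ K L, p (b (MvPolynomial.monomial K 1) (MvPolynomial.monomial L 1)) ≤
      pnorm n (MvPolynomial.monomial K (1 : ℂ)) * pnorm n (MvPolynomial.monomial L (1 : ℂ)))
    (f g : Pol d) : p (b f g) ≤ pnorm n f * pnorm n g := by
  rw [mul_comm]
  refine seminorm_map_le_pnorm p (b.flip g) (fun K => ?_) f
  rw [mul_comm]
  exact seminorm_map_le_pnorm p (b (MvPolynomial.monomial K 1)) (fun L => h K L) g

lemma constr_monomial {V : Type*} [AddCommGroup V] [Module ℂ V] (c : (Fin d →₀ ℕ) → V)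
    (K : Fin d →₀ ℕ) :
    (MvPolynomial.basisMonomials (Fin d) ℂ).constr ℂ c (MvPolynomial.monomial K 1) = c K := by
  have := (MvPolynomial.basisMonomials (Fin d) ℂ).constr_basis ℂ c K
  rwa [MvPolynomial.coe_basisMonomials] at this

/-- On polynomials of degree at most `D` all MacGyver norms are comparable with the `ℓ¹`-norm. -/
lemma pnorm_le_of_degree_le {n D : ℕ} {f : Pol d}
    (h : ∀ J, MvPolynomial.coeff J f ≠ 0 → J.degree ≤ D) :
    pnorm n f ≤ ((n : ℝ) + 1) ^ (D ^ 2) * pnorm 0 f := by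
  rw [pnorm_apply, pnorm_apply, Finset.mul_sum]
  refine Finset.sum_le_sum fun J hJ => ?_
  have hJ' := h J (MvPolynomial.mem_support_iff.1 hJ)
  simp only [Nat.cast_zero, zero_add, one_pow, mul_one]
  rw [mul_comm]
  gcongr
  linarith [(Nat.cast_nonneg n : (0 : ℝ) ≤ n)]

/-- Each MacGyver norm is attained at a polynomial by a functional that it dominates. -/
lemma exists_functional_eq_pnorm (n : ℕ) (f : Pol d) :
    ∃ ℓ : Pol d →ₗ[ℂ] ℂ, (∀ g, ‖ℓ g‖ ≤ pnorm n g) ∧ ℓ f = pnorm n f := by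
  classical
  let u : (Fin d →₀ ℕ) → ℂ := fun L =>
    (starRingEnd ℂ (MvPolynomial.coeff L f) / ‖MvPolynomial.coeff L f‖ : ℂ) *
      ((n : ℂ) + 1) ^ (L.degree ^ 2)
  have hu : ∀ L, ‖u L‖ ≤ ((n : ℝ) + 1) ^ (L.degree ^ 2) := by
    intro L
    have h1 : ‖((n : ℂ) + 1)‖ = (n : ℝ) + 1 := by
      exact_mod_cast Complex.norm_natCast (n + 1)
    rw [norm_mul, norm_pow, h1, norm_div, RCLike.norm_conj, Complex.norm_real, norm_norm]
    refine mul_le_of_le_one_left (by positivity) (div_self_le_one _)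
  refine ⟨∑ L ∈ f.support, u L • MvPolynomial.lcoeff ℂ L, fun g => ?_, ?_⟩
  · have := seminorm_map_le_pnorm (normSeminorm ℂ ℂ)
      (∑ L ∈ f.support, u L • MvPolynomial.lcoeff ℂ L) (M := 1) (n := n) (fun K => ?_) g
    · simpa using this
    · have : (∑ L ∈ f.support, u L • MvPolynomial.lcoeff ℂ L)
          (MvPolynomial.monomial K (1 : ℂ)) = if K ∈ f.support then u K else 0 := by
        simp [MvPolynomial.lcoeff_apply, MvPolynomial.coeff_monomial]
      rw [this, one_mul, pnorm_monomial, coe_normSeminorm]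
      split_ifs
      · exact hu K
      · rw [norm_zero]; positivity
  · rw [pnorm_apply]
    simp only [LinearMap.sum_apply, LinearMap.smul_apply, MvPolynomial.lcoeff_apply, smul_eq_mul]
    push_cast
    refine Finset.sum_congr rfl fun L hL => ?_
    have h0 : (‖MvPolynomial.coeff L f‖ : ℂ) ≠ 0 := by
      exact_mod_cast norm_ne_zero_iff.2 (MvPolynomial.mem_support_iff.1 hL)
    have h1 := RCLike.conj_mul (MvPolynomial.coeff L f)
    simp only [u]
    rw [mul_right_comm, div_mul_eq_mul_div, h1]
    simp only [Complex.coe_algebraMap]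
    field_simp

/-! ### Evaluating the combinatorial star product -/

variable {φ : Fin d → Fin d → PowerSeries (Pol d)}

lemma coeff_starProd_C (f g : Pol d) (n : ℕ) :
    PowerSeries.coeff n (starProd φ (PowerSeries.C f) (PowerSeries.C g)) = starCoeff φ n f g := by
  rw [starProd, PowerSeries.coeff_mk, Finset.sum_eq_single (n, 0)]
  · simp
  · rintro ⟨a, b⟩ hab hne
    refine Finset.sum_eq_zero ?_
    rintro ⟨x, y⟩ hxy
    rw [Finset.HasAntidiagonal.mem_antidiagonal] at hab hxy
    simp only at hab hxy
    have hb : b ≠ 0 := by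
      rintro rfl
      exact hne (by simp [← hab])
    by_cases hx : x = 0
    · have hy : y ≠ 0 := by omega
      simp [PowerSeries.coeff_C, hy]
    · simp [PowerSeries.coeff_C, hx]
  · simp

lemma starCoeff_monomial (n : ℕ) (K L : Fin d →₀ ℕ) :
    starCoeff φ n (MvPolynomial.monomial K 1) (MvPolynomial.monomial L 1) =
      abelianize (PowerSeries.coeff n (normalForm φ (wordProduct K L))) := by
  rw [starCoeff, constr_monomial, constr_monomial]

lemma coeffSeries_starProd_C (f g : Pol d) (J : Fin d →₀ ℕ) :
    coeffSeries J (starProd φ (PowerSeries.C f) (PowerSeries.C g)) =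
      PowerSeries.mk fun n => MvPolynomial.coeff J (starCoeff φ n f g) := by
  ext n
  simp [coeffSeries, coeff_starProd_C]

lemma abelianize_word (w : List (Fin d)) :
    ∃ K, abelianize (word w) = MvPolynomial.monomial K (1 : ℂ) := by
  induction w with
  | nil => exact ⟨0, by rw [word_nil, map_one]; rfl⟩
  | cons a w ih =>
    obtain ⟨K, hK⟩ := ih
    refine ⟨Finsupp.single a 1 + K, ?_⟩
    rw [show word (a :: w) = word [a] * word w from word_append [a] w, map_mul, hK,
      ← one_mul (1 : ℂ), ← MvPolynomial.monomial_mul, one_mul]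
    congr 1
    simp [abelianize, word, MvPolynomial.X]

lemma pnorm_abelianize_le (x : FreeAlg d) : pnorm 0 (abelianize x) ≤ wordNorm x := by
  simpa using seminorm_map_le_wordNorm (pnorm 0) abelianize.toLinearMap (M := 1) (fun w => by
    obtain ⟨K, hK⟩ := abelianize_word w
    simp [hK]) x

lemma stdWord_single (j : Fin d) : stdWord (Finsupp.single j 1) = [j] := by
  have key : ∀ l : List (Fin d), l.Nodup →
      l.flatMap (fun i => List.replicate (Finsupp.single j 1 i) i) = if j ∈ l then [j] else [] := by
    intro l hl
    induction l with
    | nil => simp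
    | cons a l ih =>
      rw [List.flatMap_cons, ih hl.of_cons]
      have ha : a ∉ l := (List.nodup_cons.1 hl).1
      by_cases h : j = a
      · subst h
        simp [ha]
      · simp [h]
  rw [stdWord, key _ (List.nodup_finRange d)]
  simp

lemma abelianize_stdLift (f : Pol d) : abelianize (stdLift f) = f := by
  have h : abelianize.toLinearMap ∘ₗ stdLift (d := d) = LinearMap.id := by
    refine (MvPolynomial.basisMonomials (Fin d) ℂ).ext fun K => ?_
    rw [LinearMap.comp_apply, stdLift, Module.Basis.constr_basis]
    have : ∀ w : List (Fin d), abelianize (word w) = (w.map MvPolynomial.X).prod := by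
      intro w
      simp [abelianize, word, FreeMonoid.lift_apply]
    simp only [AlgHom.toLinearMap_apply, this, stdWord, MvPolynomial.coe_basisMonomials,
      LinearMap.id_apply]
    rw [MvPolynomial.monomial_eq, List.map_flatMap, List.flatMap_def, List.prod_flatten,
      List.map_map, Finsupp.prod_fintype _ _ (by simp)]
    simp [Function.comp_def, List.prod_ofFn, ← List.ofFn_eq_map]
  exact LinearMap.congr_fun h f

lemma isStandard_C_word {w : List (Fin d)} (hw : IsStdWord w) :
    IsStandard (PowerSeries.C (word w)) := by
  intro n v hv
  rw [PowerSeries.coeff_C] at hv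
  split_ifs at hv
  · have := Finsupp.support_single_subset hv
    simp only [Finset.mem_singleton] at this
    subst this
    exact hw
  · simp at hv

lemma isStdWord_stdWord (K : Fin d →₀ ℕ) : IsStdWord (stdWord K) := by
  rw [IsStdWord, stdWord, List.pairwise_flatMap]
  refine ⟨fun i _ => by simp [List.pairwise_replicate], ?_⟩
  refine (List.pairwise_lt_finRange d).imp ?_
  intro a b hab x hx y hy
  rw [List.eq_of_mem_replicate hx, List.eq_of_mem_replicate hy]
  exact hab.le

lemma isStandard_stdLift (f : PowerSeries (Pol d)) :
    IsStandard (PowerSeries.mk fun n => stdLift (PowerSeries.coeff n f)) := by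
  intro n w hw
  rw [PowerSeries.coeff_mk] at hw
  have h := eq_sum_monomials (PowerSeries.coeff n f)
  by_contra hc
  refine (Finsupp.mem_support_iff.1 hw) ?_
  rw [h, map_sum, MonoidAlgebra.coeff_sum, Finsupp.finsetSum_apply]
  refine Finset.sum_eq_zero fun K _ => ?_
  rw [map_smul, stdLift, constr_monomial]
  have : (word (stdWord K)).coeff w = 0 := by
    rw [← Finsupp.notMem_support_iff]
    intro hm
    have := Finsupp.support_single_subset hm
    simp only [Finset.mem_singleton] at this
    exact hc (this ▸ isStdWord_stdWord K)
  simp [this]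

lemma isStandard_add {F G : PowerSeries (FreeAlg d)} (hF : IsStandard F) (hG : IsStandard G) :
    IsStandard (F + G) := by
  classical
  intro n w hw
  rw [map_add] at hw
  rcases Finset.mem_union.1 (Finsupp.support_add hw) with h | h
  exacts [hF n w h, hG n w h]

/-- For `i < j` the product `x_j ⋆ x_i` equals `x_j x_i + φ (x_j x_i)`, so that the reduction rules
can be recovered from the products of the generators. -/
lemma starCoeff_X_X (hφ : ∀ i j, i < j → PowerSeries.constantCoeff (φ j i) = 0) {i j : Fin d}
    (hij : i < j) (n : ℕ) :
    starCoeff φ n (MvPolynomial.X j) (MvPolynomial.X i) =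
      PowerSeries.coeff n (PowerSeries.C (MvPolynomial.X j * MvPolynomial.X i) + φ j i) := by
  have hw : wordProduct (Finsupp.single j 1) (Finsupp.single i 1) =
      PowerSeries.C (word [j, i]) := by
    rw [wordProduct, stdWord_single, stdWord_single]
    rfl
  have hr : (reduce φ)^[1] (wordProduct (Finsupp.single j 1) (Finsupp.single i 1)) =
      PowerSeries.C (word [i, j]) +
        PowerSeries.mk fun n => stdLift (PowerSeries.coeff n (φ j i)) := by
    rw [hw, Function.iterate_one, reduce_C_word]
    simp [reduceWord, hij, word_nil]
  have hs : IsStandard ((reduce φ)^[1]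
      (wordProduct (Finsupp.single j 1) (Finsupp.single i 1))) := by
    rw [hr]
    exact isStandard_add (isStandard_C_word (by simp [hij.le])) (isStandard_stdLift _)
  have hab : abelianize (word [i, j]) = (MvPolynomial.X j * MvPolynomial.X i : Pol d) := by
    simp [abelianize, word, FreeMonoid.lift_apply, mul_comm]
  rw [MvPolynomial.X, MvPolynomial.X, starCoeff_monomial, normalForm_eq hφ hs, hr, map_add,
    map_add, map_add, PowerSeries.coeff_mk, abelianize_stdLift, PowerSeries.coeff_C,
    PowerSeries.coeff_C]
  split_ifs
  · rw [hab]; rfl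
  · rw [map_zero]

lemma isFamily_of_coeffSeries {f : PowerSeries (Pol d)} (hfin : {K | coeffSeries K f ≠ 0}.Finite)
    (h : ∀ K, ∃ q : ℂ → ℂ, IsExpansion Ω q (coeffSeries K f)) :
    ∃ F : ℂ → Pol d, IsFamily Ω F f := by
  choose q hq using h
  refine ⟨_, (IsFamily.sum hfin.toFinset fun K _ =>
    IsFamily.smul (MvPolynomial.monomial K (1 : ℂ)) (hq K)).congr (fun _ => rfl) fun n => ?_⟩
  rw [map_sum]
  simp only [PowerSeries.coeff_mk, coeffSeries]
  conv_rhs => rw [eq_sum_monomials (PowerSeries.coeff n f)]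
  symm
  refine Finset.sum_subset (fun K hK => ?_) fun K _ hK => ?_
  · rw [Set.Finite.mem_toFinset]
    intro h0
    refine MvPolynomial.mem_support_iff.1 hK ?_
    simpa [coeffSeries] using congrArg (PowerSeries.coeff n) h0
  · rw [MvPolynomial.notMem_support_iff.1 hK, zero_smul]

/-- The reduction rules depend holomorphically on the parameter. -/
lemma exists_rule_family (hφ : ∀ i j, i < j → PowerSeries.constantCoeff (φ j i) = 0)
    (hΩ : IsOpen Ω) (h0 : (0 : ℂ) ∈ Ω)
    (ha : ∀ i j : Fin d,
      {K | coeffSeries K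
        (starProd φ (PowerSeries.C (MvPolynomial.X i)) (PowerSeries.C (MvPolynomial.X j))) ≠ 0}.Finite
      ∧
      ∀ K, ∃ q : ℂ → ℂ, IsExpansion Ω q (coeffSeries K
        (starProd φ (PowerSeries.C (MvPolynomial.X i)) (PowerSeries.C (MvPolynomial.X j))))) :
    ∃ Φ : Fin d → Fin d → ℂ → Pol d, ∀ a b, b < a → IsFamily Ω (Φ a b) (φ a b) := by
  have : ∀ a b : Fin d, ∃ F : ℂ → Pol d, b < a → IsFamily Ω F (φ a b) := by
    intro a b
    by_cases hab : b < a
    · obtain ⟨F, hF⟩ := isFamily_of_coeffSeries (ha a b).1 (ha a b).2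
      refine ⟨_, fun _ => (hF.add ((IsFamily.const
        (MvPolynomial.X a * MvPolynomial.X b)).smul_const (-1) hΩ h0)).congr (fun _ => rfl) ?_⟩
      intro n
      rw [map_add, coeff_starProd_C, starCoeff_X_X hφ hab]
      simp
    · exact ⟨0, fun h => absurd h hab⟩
  choose Φ hΦ using this
  exact ⟨Φ, hΦ⟩

lemma map₂_eq_sum {V : Type*} [AddCommGroup V] [Module ℂ V] (b : Pol d →ₗ[ℂ] Pol d →ₗ[ℂ] V)
    (f g : Pol d) : b f g = ∑ K ∈ f.support, ∑ L ∈ g.support,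
      MvPolynomial.coeff K f • MvPolynomial.coeff L g •
        b (MvPolynomial.monomial K 1) (MvPolynomial.monomial L 1) := by
  conv_lhs => rw [eq_sum_monomials f, eq_sum_monomials g]
  simp only [map_sum, map_smul, LinearMap.sum_apply, LinearMap.smul_apply, Finset.smul_sum]
  rw [Finset.sum_comm]
  exact Finset.sum_congr rfl fun K _ => Finset.sum_congr rfl fun L _ => smul_comm _ _ _

/-- The products `s ħ` depend holomorphically on `ħ ∈ Ω` and expand to the star product. -/
def IsStarFamily (Ω : Set ℂ) (φ : Fin d → Fin d → PowerSeries (Pol d))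
    (s : ℂ → Pol d →ₗ[ℂ] Pol d →ₗ[ℂ] Pol d) : Prop :=
  ∀ f g, IsFamily Ω (fun ħ => s ħ f g) (PowerSeries.mk fun n => starCoeff φ n f g)

/-- The products `s ħ` satisfy continuity estimates for the MacGyver norms, locally uniformly in
`ħ ∈ Ω`. -/
def HasLocalBounds (s : ℂ → Pol d →ₗ[ℂ] Pol d →ₗ[ℂ] Pol d) (Ω : Set ℂ) : Prop :=
  ∀ C ⊆ Ω, IsCompact C → ∀ n, ∃ m, ∀ ħ ∈ C, ∀ f g, pnorm n (s ħ f g) ≤ pnorm m f * pnorm m g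

/-- The combinatorial star product can be evaluated at the points of `Ω`, with continuity estimates
that are locally uniform in the parameter. The product `x^K ⋆ x^L` is obtained by `O((|K| + |L|)²)`
reductions, each of which multiplies the `ℓ¹`-norm by a bounded factor, and has degree
`O(|K| + |L|)`. Hence its MacGyver norms are at most `B ^ (|K| + |L|)²` with a constant `B`, and
`(|K| + |L|)² ≤ 2 |K|² + 2 |L|²`. -/
lemma exists_evaluation (hφ : ∀ i j, i < j → PowerSeries.constantCoeff (φ j i) = 0)
    (hΩ : IsOpen Ω) (hΩc : IsConnected Ω) (h0 : (0 : ℂ) ∈ Ω)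
    (ha : ∀ i j : Fin d,
      {K | coeffSeries K
        (starProd φ (PowerSeries.C (MvPolynomial.X i)) (PowerSeries.C (MvPolynomial.X j))) ≠ 0}.Finite
      ∧
      ∀ K, ∃ q : ℂ → ℂ, IsExpansion Ω q (coeffSeries K
        (starProd φ (PowerSeries.C (MvPolynomial.X i)) (PowerSeries.C (MvPolynomial.X j)))))
    (hb : ∃ α : ℝ, ∀ K L : Fin d →₀ ℕ, ∃ N : ℕ, (N : ℝ) ≤ α * (K.degree + L.degree : ℝ) ^ 2 ∧
      IsStandard ((reduce φ)^[N] (wordProduct K L)))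
    (hc : ∃ β : ℝ, ∀ K L J : Fin d →₀ ℕ, coeffSeries J (starProd φ (mon K) (mon L)) ≠ 0 →
      (J.degree : ℝ) ≤ β * (K.degree + L.degree : ℝ)) :
    ∃ s : ℂ → Pol d →ₗ[ℂ] Pol d →ₗ[ℂ] Pol d,
      IsStarFamily Ω φ s ∧ HasLocalBounds s Ω := by
  obtain ⟨Φ, hΦ⟩ := exists_rule_family hφ hΩ h0 ha
  obtain ⟨α, hα⟩ := hb
  obtain ⟨β, hβ⟩ := hc
  choose N hN hst using hα
  have hN' : ∀ K L, N K L ≤ ⌈α⌉₊ * (K.degree + L.degree) ^ 2 := by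
    intro K L
    have : (N K L : ℝ) ≤ (⌈α⌉₊ * (K.degree + L.degree) ^ 2 : ℕ) := by
      refine (hN K L).trans ?_
      push_cast
      gcongr
      exact Nat.le_ceil α
    exact_mod_cast this
  have hfam : ∀ K L : Fin d →₀ ℕ, ∃ F : ℂ → Pol d,
      IsFamily Ω F (PowerSeries.mk fun n =>
        starCoeff φ n (MvPolynomial.monomial K 1) (MvPolynomial.monomial L 1)) ∧
      ∀ ħ, pnorm 0 (F ħ) ≤ reductionBound Φ ħ ^ N K L := by
    intro K L
    obtain ⟨F, hF, hn⟩ := exists_iterate_family hΦ hΩ h0 (stdWord K ++ stdWord L) (N K L)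
    refine ⟨_, (hF.map abelianize.toLinearMap).congr (fun _ => rfl) fun n => ?_,
      fun ħ => (pnorm_abelianize_le _).trans (hn ħ)⟩
    rw [PowerSeries.coeff_mk, PowerSeries.coeff_mk, starCoeff_monomial,
      normalForm_eq hφ (hst K L)]
    rfl
  choose F hF hFn using hfam
  have hdeg : ∀ K L J, ∀ ħ ∈ Ω, MvPolynomial.coeff J (F K L ħ) ≠ 0 →
      J.degree ≤ ⌈β⌉₊ * (K.degree + L.degree) := by
    intro K L J ħ hħ hJ
    by_contra hlt
    have hz : coeffSeries J (starProd φ (mon K) (mon L)) = 0 := by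
      by_contra hne
      refine hlt ?_
      have : (J.degree : ℝ) ≤ (⌈β⌉₊ * (K.degree + L.degree) : ℕ) := by
        refine (hβ K L J hne).trans ?_
        push_cast
        gcongr
        exact Nat.le_ceil β
      exact_mod_cast this
    refine hJ ?_
    have h1 := (hF K L).functional (MvPolynomial.lcoeff ℂ J) hΩ h0
    rw [mon, mon, coeffSeries_starProd_C] at hz
    simp only [PowerSeries.coeff_mk, MvPolynomial.lcoeff_apply] at h1
    rw [hz, ← map_zero PowerSeries.C] at h1
    exact h1.eqOn (isExpansion_const 0) hΩ hΩc h0 hħ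
  let s : ℂ → Pol d →ₗ[ℂ] Pol d →ₗ[ℂ] Pol d := fun ħ =>
    (MvPolynomial.basisMonomials (Fin d) ℂ).constr ℂ fun K =>
      (MvPolynomial.basisMonomials (Fin d) ℂ).constr ℂ fun L => F K L ħ
  have hs : ∀ ħ K L, s ħ (MvPolynomial.monomial K 1) (MvPolynomial.monomial L 1) = F K L ħ := by
    intro ħ K L
    simp only [s, constr_monomial]
  refine ⟨s, fun f g => ?_, fun C hC hCc n => ?_⟩
  · refine (IsFamily.sum f.support fun K _ => IsFamily.sum g.support fun L _ =>
      ((hF K L).smul_const (MvPolynomial.coeff L g) hΩ h0).smul_const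
        (MvPolynomial.coeff K f) hΩ h0).congr (fun ħ => ?_) fun n => ?_
    · simp only [map₂_eq_sum (s ħ) f g, hs]
    · simp [map₂_eq_sum (starCoeff φ n) f g]
  · obtain ⟨M, hM⟩ := exists_reductionBound_le hΦ hCc hC
    have hM' : ∀ ħ ∈ C, reductionBound Φ ħ ≤ (⌈M⌉₊ + 1 : ℕ) := fun ħ hħ =>
      ((hM ħ hħ).trans (Nat.le_ceil M)).trans (by push_cast; linarith)
    -- the estimate of `x^K ⋆ x^L` grows like `B ^ (|K| + |L|)²`
    let B : ℕ := (⌈M⌉₊ + 1) ^ ⌈α⌉₊ * (n + 1) ^ (⌈β⌉₊ ^ 2)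
    have hB : 1 ≤ B := Nat.one_le_iff_ne_zero.2 (by positivity)
    have hB' : (((B ^ 2 - 1 : ℕ) : ℝ) + 1) = (B : ℝ) ^ 2 := by
      rw [Nat.cast_sub (Nat.one_le_pow _ _ hB)]
      push_cast
      ring
    refine ⟨B ^ 2 - 1, fun ħ hħ f g => seminorm_map₂_le_pnorm _ (s ħ) (fun K L => ?_) f g⟩
    rw [hs, pnorm_monomial, pnorm_monomial, hB']
    refine (pnorm_le_of_degree_le fun J hJ => hdeg K L J ħ (hC hħ) hJ).trans ?_
    have h1 : pnorm 0 (F K L ħ) ≤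
        ((⌈M⌉₊ + 1 : ℕ) : ℝ) ^ (⌈α⌉₊ * (K.degree + L.degree) ^ 2) := by
      refine (hFn K L ħ).trans ((pow_le_pow_left₀
        (zero_le_one.trans (one_le_reductionBound ħ)) (hM' ħ hħ) _).trans ?_)
      exact pow_le_pow_right₀ (by push_cast; linarith [(Nat.cast_nonneg ⌈M⌉₊ : (0 : ℝ) ≤ ⌈M⌉₊)])
        (hN' K L)
    have hB1 : (1 : ℝ) ≤ B := by exact_mod_cast hB
    calc ((n : ℝ) + 1) ^ ((⌈β⌉₊ * (K.degree + L.degree)) ^ 2) * pnorm 0 (F K L ħ)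
        ≤ ((n : ℝ) + 1) ^ ((⌈β⌉₊ * (K.degree + L.degree)) ^ 2) *
          ((⌈M⌉₊ + 1 : ℕ) : ℝ) ^ (⌈α⌉₊ * (K.degree + L.degree) ^ 2) := by gcongr
      _ = (B : ℝ) ^ ((K.degree + L.degree) ^ 2) := by
          simp only [B]
          push_cast
          rw [mul_pow, mul_pow, pow_mul, pow_mul, mul_comm]
      _ ≤ (B : ℝ) ^ (2 * K.degree ^ 2 + 2 * L.degree ^ 2) :=
          pow_le_pow_right₀ hB1 (by zify; nlinarith [sq_nonneg ((K.degree : ℤ) - L.degree)])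
      _ = _ := by rw [pow_add, pow_mul, pow_mul]

/-! ### The evaluated products of polynomials -/

variable {s : ℂ → Pol d →ₗ[ℂ] Pol d →ₗ[ℂ] Pol d}

lemma IsStarFamily.functional (hs : IsStarFamily Ω φ s) (hΩ : IsOpen Ω) (h0 : (0 : ℂ) ∈ Ω)
    (ℓ : Pol d →ₗ[ℂ] ℂ) (f g : Pol d) :
    IsExpansion Ω (fun ħ => ℓ (s ħ f g)) (PowerSeries.mk fun n => ℓ (starCoeff φ n f g)) := by
  simpa using (hs f g).functional ℓ hΩ h0

lemma IsStarFamily.isEvaluation (hs : IsStarFamily Ω φ s) (hΩ : IsOpen Ω) (h0 : (0 : ℂ) ∈ Ω) :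
    IsEvaluation Ω φ s := by
  intro f g J
  rw [coeffSeries_starProd_C]
  exact hs.functional hΩ h0 (MvPolynomial.lcoeff ℂ J) f g

lemma IsEvaluation.eq {s' : ℂ → Pol d →ₗ[ℂ] Pol d →ₗ[ℂ] Pol d} (h : IsEvaluation Ω φ s)
    (h' : IsEvaluation Ω φ s') (hΩ : IsOpen Ω) (hΩc : IsConnected Ω) (h0 : (0 : ℂ) ∈ Ω) {ħ : ℂ}
    (hħ : ħ ∈ Ω) : s ħ = s' ħ := by
  refine LinearMap.ext fun f => LinearMap.ext fun g => MvPolynomial.ext _ _ fun J => ?_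
  exact (h f g J).eqOn (h' f g J) hΩ hΩc h0 hħ

lemma IsEvaluation.zero_eq (h : IsEvaluation Ω φ s) (f g : Pol d) :
    s 0 f g = starCoeff φ 0 f g := by
  refine MvPolynomial.ext _ _ fun J => ?_
  have := (h f g J).2 0
  rw [coeffSeries_starProd_C] at this
  simpa using this.symm

lemma starProd_add_left (f f' g : PowerSeries (Pol d)) :
    starProd φ (f + f') g = starProd φ f g + starProd φ f' g := by
  ext1 n
  simp [starProd, Finset.sum_add_distrib]

lemma starProd_add_right (f g g' : PowerSeries (Pol d)) :
    starProd φ f (g + g') = starProd φ f g + starProd φ f g' := by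
  ext1 n
  simp [starProd, Finset.sum_add_distrib]

/-- The product of two holomorphic families expands to the star product of their expansions. -/
lemma IsStarFamily.star (hs : IsStarFamily Ω φ s) (hΩ : IsOpen Ω) (h0 : (0 : ℂ) ∈ Ω)
    {F G : ℂ → Pol d} {f g : PowerSeries (Pol d)} (hF : IsFamily Ω F f) (hG : IsFamily Ω G g) :
    IsFamily Ω (fun ħ => s ħ (F ħ) (G ħ)) (starProd φ f g) := by
  induction hF with
  | @smul a c v h =>
    induction hG with
    | @smul a' c' v' h' =>
      refine ((hs v v').expansion_smul (h.mul h' hΩ h0) hΩ h0).congr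
        (fun ħ => by simp [mul_smul, smul_comm (a ħ)]) fun n => ?_
      rw [starProd, PowerSeries.coeff_mk, PowerSeries.coeff_mk,
        ← Finset.Nat.sum_antidiagonal_swap]
      refine Finset.sum_congr rfl fun p _ => ?_
      simp only [Prod.fst_swap, Prod.snd_swap, PowerSeries.coeff_mul, PowerSeries.coeff_mk,
        Finset.sum_smul, map_smul, LinearMap.smul_apply, mul_smul]
      exact Finset.sum_congr rfl fun x _ => smul_comm _ _ _
    | add _ _ h1 h2 =>
      rw [starProd_add_right]
      exact (h1.add h2).congr (by simp) fun _ => rfl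
  | add _ _ h1 h2 =>
    rw [starProd_add_left]
    exact (h1.add h2).congr (by simp) fun _ => rfl

lemma IsStarFamily.assoc (hs : IsStarFamily Ω φ s)
    (hφ : ∀ F G H : PowerSeries (Pol d),
      starProd φ (starProd φ F G) H = starProd φ F (starProd φ G H))
    (hΩ : IsOpen Ω) (hΩc : IsConnected Ω) (h0 : (0 : ℂ) ∈ Ω) {ħ : ℂ} (hħ : ħ ∈ Ω) (f g h : Pol d) :
    s ħ (s ħ f g) h = s ħ f (s ħ g h) := by
  have hc := fun v : Pol d => IsFamily.const (Ω := Ω) v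
  have h1 := hs.star hΩ h0 (hs.star hΩ h0 (hc f) (hc g)) (hc h)
  have h2 := hs.star hΩ h0 (hc f) (hs.star hΩ h0 (hc g) (hc h))
  rw [hφ] at h1
  refine MvPolynomial.ext _ _ fun J => ?_
  exact (h1.functional (MvPolynomial.lcoeff ℂ J) hΩ h0).eqOn
    (h2.functional (MvPolynomial.lcoeff ℂ J) hΩ h0) hΩ hΩc h0 hħ

section Estimates

variable {ρ : ℝ} {m n : ℕ}

lemma IsStarFamily.pnorm_starCoeff_le (hs : IsStarFamily Ω φ s) (hΩ : IsOpen Ω)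
    (h0 : (0 : ℂ) ∈ Ω) (hρ : 0 < ρ) (hρΩ : Metric.closedBall 0 ρ ⊆ Ω)
    (hM : ∀ ħ ∈ Metric.closedBall (0 : ℂ) ρ, ∀ f g, pnorm n (s ħ f g) ≤ pnorm m f * pnorm m g)
    (k : ℕ) (f g : Pol d) :
    pnorm n (starCoeff φ k f g) ≤ (ρ ^ k)⁻¹ * (pnorm m f * pnorm m g) := by
  obtain ⟨ℓ, hℓ, he⟩ := exists_functional_eq_pnorm n (starCoeff φ k f g)
  have := (hs.functional hΩ h0 ℓ f g).norm_coeff_le hρ hρΩ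
    (fun ħ hħ => (hℓ _).trans (hM ħ hħ f g)) k
  rw [PowerSeries.coeff_mk, he, Complex.norm_real, Real.norm_of_nonneg (apply_nonneg _ _)] at this
  rwa [inv_mul_eq_div]

lemma IsStarFamily.pnorm_sub_sum_le (hs : IsStarFamily Ω φ s) (hΩ : IsOpen Ω)
    (h0 : (0 : ℂ) ∈ Ω) (hρ : 0 < ρ) (hρΩ : Metric.closedBall 0 ρ ⊆ Ω)
    (hM : ∀ ħ ∈ Metric.closedBall (0 : ℂ) ρ, ∀ f g, pnorm n (s ħ f g) ≤ pnorm m f * pnorm m g)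
    {ħ : ℂ} (hħ : ‖ħ‖ < ρ) (t : Finset ℕ) (f g : Pol d) :
    pnorm n (s ħ f g - ∑ k ∈ t, ħ ^ k • starCoeff φ k f g) ≤
      geomTail (‖ħ‖ / ρ) t * (pnorm m f * pnorm m g) := by
  obtain ⟨ℓ, hℓ, he⟩ :=
    exists_functional_eq_pnorm n (s ħ f g - ∑ k ∈ t, ħ ^ k • starCoeff φ k f g)
  have := (hs.functional hΩ h0 ℓ f g).norm_sub_sum_le hρ hρΩ
    (fun ħ hħ => (hℓ _).trans (hM ħ hħ f g)) hħ t
  have e : ℓ (s ħ f g) - ∑ k ∈ t, ħ ^ k *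
      PowerSeries.coeff k (PowerSeries.mk fun n => ℓ (starCoeff φ n f g)) =
      ℓ (s ħ f g - ∑ k ∈ t, ħ ^ k • starCoeff φ k f g) := by
    simp
  rw [e, he, Complex.norm_real, Real.norm_of_nonneg (apply_nonneg _ _)] at this
  rwa [mul_comm]

end Estimates

/-! ### The completion -/

lemma withSeminorms_pnorm : WithSeminorms (pnorm (d := d)) := by
  refine withSeminorms_macGyver.congr ?_ ?_
  · intro n
    exact ⟨{⟨n + 1, by simp only [Set.mem_Ioi]; positivity⟩}, 1, by simp [pnorm]⟩
  · intro C
    refine ⟨{⌈(C : ℝ)⌉₊}, 1, fun f => ?_⟩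
    have hC : (0 : ℝ) < C := C.2
    simp only [Finset.sup_singleton, one_smul, Seminorm.comp_id]
    change ∑ L ∈ f.support, ‖MvPolynomial.coeff L f‖ * (C : ℝ) ^ (L.degree ^ 2) ≤ pnorm _ f
    rw [pnorm_apply]
    gcongr
    exact (Nat.le_ceil _).trans (by linarith)

lemma continuous_pnorm (n : ℕ) : Continuous (pnorm (d := d) n) :=
  withSeminorms_pnorm.continuous_seminorm n

lemma continuous_of_pnorm_le {b : Pol d →ₗ[ℂ] Pol d →ₗ[ℂ] Pol d}
    (h : ∀ n, ∃ m, ∃ M : ℝ, ∀ f g, pnorm n (b f g) ≤ M * (pnorm m f * pnorm m g)) :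
    Continuous fun x : Pol d × Pol d => b x.1 x.2 := by
  rw [continuous_iff_continuousAt]
  rintro ⟨f₀, g₀⟩
  refine (withSeminorms_pnorm.tendsto_nhds _ _).2 fun n ε hε => ?_
  obtain ⟨m, M, hM⟩ := h n
  have hc := continuous_pnorm (d := d) m
  have h1 : Continuous fun x : Pol d × Pol d =>
      M * (pnorm m (x.1 - f₀) * pnorm m x.2) + M * (pnorm m f₀ * pnorm m (x.2 - g₀)) := by
    fun_prop
  have h2 := h1.tendsto (f₀, g₀)
  simp only [sub_self, map_zero, zero_mul, mul_zero, add_zero] at h2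
  filter_upwards [h2.eventually (gt_mem_nhds hε)] with x hx
  have e : b x.1 x.2 - b f₀ g₀ = b (x.1 - f₀) x.2 + b f₀ (x.2 - g₀) := by
    simp
  rw [e]
  exact ((map_add_le_add _ _ _).trans (add_le_add (hM _ _) (hM _ _))).trans_lt hx

open UniformSpace.Completion in
/-- A continuous bilinear map on the polynomials extends to the completion. -/
lemma exists_isContExtension {b : Pol d →ₗ[ℂ] Pol d →ₗ[ℂ] Pol d}
    (hb : Continuous fun x : Pol d × Pol d => b x.1 x.2) : ∃ b', IsContExtension b b' := by
  let φ : Pol d →+ Pol d →+ PolHat d :=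
    AddMonoidHom.mk' (fun f => AddMonoidHom.mk' (fun g => (b f g : PolHat d))
      fun g g' => by rw [map_add, coe_add]) fun f f' => by
        ext g
        simp [coe_add]
  have hφ : Continuous fun p : Pol d × Pol d => φ p.1 p.2 := (continuous_coe _).comp hb
  have di : IsDenseInducing (toCompl : Pol d →+ PolHat d) := isDenseInducing_coe
  have hB := di.extend_Z_bilin di hφ
  set B : PolHat d × PolHat d → PolHat d :=
    (di.prodMap di).extend (fun p : Pol d × Pol d => φ p.1 p.2) with hBdef
  have hB' : ∀ f g : Pol d, B ((f : PolHat d), (g : PolHat d)) = (b f g : PolHat d) :=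
    fun f g => (di.prodMap di).extend_eq hφ (f, g)
  refine ⟨LinearMap.mk₂ ℂ (fun x y => B (x, y)) ?_ ?_ ?_ ?_, hB, hB'⟩
  · intro x x' y
    induction x, x', y using induction_on₃ with
    | hp => exact isClosed_eq (by fun_prop) (by fun_prop)
    | ih f f' g => rw [← coe_add, hB', hB', hB', map_add, LinearMap.add_apply, coe_add]
  · intro c x y
    have hc : Continuous fun x : PolHat d => c • x := continuous_const_smul c
    induction x, y using induction_on₂ with
    | hp =>
      refine isClosed_eq ?_ ?_
      · exact hB.comp ((hc.comp continuous_fst).prodMk continuous_snd)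
      · exact hc.comp hB
    | ih f g => rw [← coe_smul, hB', hB', map_smul, LinearMap.smul_apply, coe_smul]
  · intro x y y'
    induction x, y, y' using induction_on₃ with
    | hp => exact isClosed_eq (by fun_prop) (by fun_prop)
    | ih f g g' => rw [← coe_add, hB', hB', hB', map_add, coe_add]
  · intro c x y
    have hc : Continuous fun x : PolHat d => c • x := continuous_const_smul c
    induction x, y using induction_on₂ with
    | hp =>
      refine isClosed_eq ?_ ?_
      · exact hB.comp (continuous_fst.prodMk (hc.comp continuous_snd))
      · exact hc.comp hB
    | ih f g => rw [← coe_smul, hB', hB', map_smul, coe_smul]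

open UniformSpace.Completion in
lemma IsContExtension.unique {b : Pol d →ₗ[ℂ] Pol d →ₗ[ℂ] Pol d}
    {b₁ b₂ : PolHat d →ₗ[ℂ] PolHat d →ₗ[ℂ] PolHat d} (h₁ : IsContExtension b b₁)
    (h₂ : IsContExtension b b₂) : b₁ = b₂ := by
  refine LinearMap.ext fun x => LinearMap.ext fun y => ?_
  induction x, y using induction_on₂ with
  | hp => exact isClosed_eq h₁.1 h₂.1
  | ih f g => rw [h₁.2, h₂.2]

/-- The continuous extensions of the MacGyver norms to the completion. -/
def hatNorm (n : ℕ) : Seminorm ℂ (PolHat d) :=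
  have hu : UniformContinuous (pnorm (d := d) n) :=
    Seminorm.uniformContinuous_of_continuousAt_zero (continuous_pnorm n).continuousAt
  have hc : Continuous (UniformSpace.Completion.extension (pnorm (d := d) n)) :=
    UniformSpace.Completion.continuous_extension
  have he : ∀ f : Pol d, UniformSpace.Completion.extension (pnorm (d := d) n) (f : PolHat d) =
      pnorm n f := UniformSpace.Completion.extension_coe hu
  Seminorm.of (UniformSpace.Completion.extension (pnorm n))
    (fun x y => by
      induction x, y using UniformSpace.Completion.induction_on₂ with
      | hp => exact isClosed_le (by fun_prop) (by fun_prop)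
      | ih f g =>
        rw [← UniformSpace.Completion.coe_add, he, he, he]
        exact map_add_le_add _ f g)
    (fun a x => by
      have ha : Continuous fun x : PolHat d => a • x := continuous_const_smul a
      induction x using UniformSpace.Completion.induction_on with
      | hp => exact isClosed_eq (hc.comp ha) (continuous_const.mul hc)
      | ih f => rw [← UniformSpace.Completion.coe_smul, he, he, map_smul_eq_mul])

@[fun_prop] lemma continuous_hatNorm (n : ℕ) : Continuous (hatNorm (d := d) n) :=
  UniformSpace.Completion.continuous_extension

@[simp] lemma hatNorm_coe (n : ℕ) (f : Pol d) : hatNorm n (f : PolHat d) = pnorm n f :=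
  UniformSpace.Completion.extension_coe
    (Seminorm.uniformContinuous_of_continuousAt_zero (continuous_pnorm n).continuousAt) f

lemma hatNorm_mono {m n : ℕ} (h : m ≤ n) : hatNorm (d := d) m ≤ hatNorm n := by
  intro x
  induction x using UniformSpace.Completion.induction_on with
  | hp => exact isClosed_le (by fun_prop) (by fun_prop)
  | ih f => simpa using pnorm_mono h f

lemma sup_pnorm_le (t : Finset ℕ) : t.sup (pnorm (d := d)) ≤ pnorm (t.sup id) :=
  Finset.sup_le fun _ hi => pnorm_mono (Finset.le_sup (f := id) hi)

/-- The topology of the completion is defined by the extended MacGyver norms. -/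
lemma withSeminorms_hatNorm : WithSeminorms (hatNorm (d := d)) := by
  refine (SeminormFamily.withSeminorms_iff_nhds_eq_iInf _).2 (le_antisymm ?_ ?_)
  · refine le_iInf fun n => tendsto_iff_comap.1 ?_
    simpa using (continuous_hatNorm (d := d) n).tendsto 0
  · intro U hU
    obtain ⟨V, hV, hVc, hVU⟩ := exists_mem_nhds_isClosed_subset hU
    have hV' : ((↑) : Pol d → PolHat d) ⁻¹' V ∈ 𝓝 0 :=
      (UniformSpace.Completion.continuous_coe (Pol d)).continuousAt
        (by rwa [UniformSpace.Completion.coe_zero])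
    obtain ⟨⟨t, ε⟩, hε, h⟩ := withSeminorms_pnorm.hasBasis_zero_ball.mem_iff.1 hV'
    have hsub : {x : PolHat d | hatNorm (t.sup id) x < ε} ⊆ U := by
      refine Set.Subset.trans ?_ hVU
      rw [← hVc.closure_eq]
      have ho : IsOpen {x : PolHat d | hatNorm (t.sup id) x < ε} :=
        isOpen_lt (continuous_hatNorm _) continuous_const
      refine (UniformSpace.Completion.denseRange_coe.open_subset_closure_inter ho).trans
        (closure_mono ?_)
      rintro _ ⟨hx, f, rfl⟩
      refine h ((Seminorm.mem_ball_zero _).2 ?_)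
      rw [Set.mem_ofPred_eq, hatNorm_coe] at hx
      exact (sup_pnorm_le t f).trans_lt hx
    refine mem_iInf_of_mem (t.sup id) (mem_of_superset (preimage_mem_comap (gt_mem_nhds hε)) hsub)

lemma exists_le_hatNorm {p : Seminorm ℂ (PolHat d)} (hp : Continuous p) :
    ∃ n, ∃ c : ℝ, 0 ≤ c ∧ ∀ x, p x ≤ c * hatNorm n x := by
  obtain ⟨t, c, -, h⟩ := Seminorm.bound_of_continuous withSeminorms_hatNorm p hp
  refine ⟨t.sup id, c, c.2, fun x => (h x).trans ?_⟩
  have : t.sup (hatNorm (d := d)) ≤ hatNorm (t.sup id) :=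
    Finset.sup_le fun _ hi => hatNorm_mono (Finset.le_sup (f := id) hi)
  exact mul_le_mul_of_nonneg_left (this x) c.2

lemma isFrechetSpace_polHat : IsFrechetSpace (PolHat d) :=
  ⟨inferInstance, inferInstance, inferInstance, hatNorm, withSeminorms_hatNorm⟩

lemma tendsto_iff_hatNorm {ι : Type*} {l : Filter ι} {u : ι → PolHat d} {y : PolHat d} :
    Tendsto u l (𝓝 y) ↔ ∀ n, Tendsto (fun i => hatNorm n (u i - y)) l (𝓝 0) := by
  rw [withSeminorms_hatNorm.tendsto_nhds]
  refine forall_congr' fun n => ?_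
  rw [Metric.tendsto_nhds]
  simp [abs_of_nonneg (apply_nonneg _ _)]

/-! ### The elements of the completion as smooth functions -/

lemma continuous_of_norm_le_pnorm {T : Pol d →ₗ[ℂ] ℂ} {n : ℕ} (h : ∀ f, ‖T f‖ ≤ pnorm n f) :
    Continuous T := by
  refine continuous_of_continuousAt_zero T ?_
  rw [ContinuousAt, map_zero]
  refine squeeze_zero_norm h ?_
  simpa using (continuous_pnorm (d := d) n).tendsto 0

lemma norm_polFun_le {n : ℕ} {x : Fin d → ℝ} (hx : ∀ i, |x i| ≤ n + 1) (f : Pol d) :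
    ‖polFun f x‖ ≤ pnorm n f := by
  have := seminorm_map_le_pnorm (normSeminorm ℂ ℂ)
    (MvPolynomial.aeval (R := ℂ) fun i => (x i : ℂ)).toLinearMap (M := 1) (n := n) (fun K => ?_) f
  · simpa [polFun] using this
  · rw [one_mul, pnorm_monomial, coe_normSeminorm, AlgHom.toLinearMap_apply,
      MvPolynomial.aeval_monomial, map_one, one_mul, Finsupp.prod_fintype _ _ (by simp), norm_prod]
    calc ∏ i, ‖(x i : ℂ) ^ K i‖ ≤ ∏ i, ((n : ℝ) + 1) ^ K i := by
          refine Finset.prod_le_prod (fun _ _ => norm_nonneg _) fun i _ => ?_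
          rw [norm_pow, Complex.norm_real]
          exact pow_le_pow_left₀ (norm_nonneg _) (hx i) _
      _ = ((n : ℝ) + 1) ^ K.degree := by
          rw [Finset.prod_pow_eq_pow_sum, Finsupp.degree_eq_sum]
      _ ≤ _ := pow_le_pow_right₀ (by linarith [(Nat.cast_nonneg n : (0 : ℝ) ≤ n)])
          (Nat.le_self_pow two_ne_zero _)

/-- The evaluation of polynomials at a point of `ℝ^d`, as a continuous functional. -/
def evalCLM (x : Fin d → ℝ) : Pol d →L[ℂ] ℂ where
  toLinearMap := (MvPolynomial.aeval (R := ℂ) fun i => (x i : ℂ)).toLinearMap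
  cont := by
    have hx : ∀ i, |x i| ≤ (⌈‖x‖⌉₊ : ℝ) + 1 := fun i =>
      ((norm_le_pi_norm x i).trans (Nat.le_ceil _)).trans (by linarith)
    refine continuous_of_norm_le_pnorm (n := ⌈‖x‖⌉₊) fun f => ?_
    simpa [polFun] using norm_polFun_le hx f

lemma evalCLM_apply (x : Fin d → ℝ) (f : Pol d) : evalCLM x f = polFun f x := by
  change MvPolynomial.aeval (R := ℂ) (fun i => (x i : ℂ)) f = _
  simp [polFun]

/-- The elements of the completion viewed as functions on `ℝ^d`. -/
def toFun : PolHat d →ₗ[ℂ] ((Fin d → ℝ) → ℂ) :=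
  LinearMap.pi fun x => (evalCLM x).fromCompletion.toLinearMap

lemma continuous_toFun (x : Fin d → ℝ) : Continuous fun f : PolHat d => toFun f x :=
  (evalCLM x).fromCompletion.continuous

lemma toFun_coe (f : Pol d) : toFun (f : PolHat d) = polFun f := by
  funext x
  exact ((evalCLM x).fromCompletion_apply_coe f).trans (evalCLM_apply x f)

lemma norm_toFun_le {n : ℕ} {x : Fin d → ℝ} (hx : ∀ i, |x i| ≤ n + 1) (f : PolHat d) :
    ‖toFun f x‖ ≤ hatNorm n f := by
  induction f using UniformSpace.Completion.induction_on with
  | hp => exact isClosed_le (continuous_toFun x).norm (continuous_hatNorm n)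
  | ih f => rw [toFun_coe, hatNorm_coe]; exact norm_polFun_le hx f

lemma pnorm_pderiv_le (n : ℕ) (i : Fin d) (f : Pol d) :
    pnorm n (MvPolynomial.pderiv i f) ≤ pnorm (2 * n + 1) f := by
  have := seminorm_map_le_pnorm (pnorm n)
    (MvPolynomial.pderiv i : Derivation ℂ (Pol d) (Pol d)).toLinearMap
    (M := 1) (n := 2 * n + 1) (fun K => ?_) f
  · simpa using this
  · have h1 : (MvPolynomial.pderiv i : Derivation ℂ (Pol d) (Pol d)).toLinearMap
        (MvPolynomial.monomial K 1) =
        (K i : ℂ) • MvPolynomial.monomial (K - Finsupp.single i 1) (1 : ℂ) := by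
      simp [MvPolynomial.pderiv_monomial, MvPolynomial.smul_monomial]
    have h2 : (K - Finsupp.single i 1).degree ≤ K.degree := by
      rw [Finsupp.degree_eq_sum, Finsupp.degree_eq_sum]
      exact Finset.sum_le_sum fun j _ => by simp
    have h3 : (K i : ℝ) ≤ 2 ^ (K.degree ^ 2) := by
      have h4 : K i ≤ K.degree := by
        rw [Finsupp.degree_eq_sum]
        exact Finset.single_le_sum (f := fun j => K j) (fun _ _ => Nat.zero_le _)
          (Finset.mem_univ i)
      have h5 : K i ≤ 2 ^ (K.degree ^ 2) :=
        (h4.trans (Nat.le_self_pow two_ne_zero _)).trans Nat.lt_two_pow_self.le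
      exact_mod_cast h5
    have hn : (1 : ℝ) ≤ (n : ℝ) + 1 := by linarith [(Nat.cast_nonneg n : (0 : ℝ) ≤ n)]
    rw [h1, map_smul_eq_mul, pnorm_monomial, pnorm_monomial, Complex.norm_natCast, one_mul]
    calc (K i : ℝ) * ((n : ℝ) + 1) ^ ((K - Finsupp.single i 1).degree ^ 2)
        ≤ 2 ^ (K.degree ^ 2) * ((n : ℝ) + 1) ^ (K.degree ^ 2) :=
          mul_le_mul h3 (pow_le_pow_right₀ hn (Nat.pow_le_pow_left h2 2)) (by positivity)
            (by positivity)
      _ = _ := by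
          rw [← mul_pow]
          push_cast
          ring

/-- The partial derivative of polynomials, as a continuous operator. -/
def pderivCLM (i : Fin d) : Pol d →L[ℂ] Pol d where
  toLinearMap := (MvPolynomial.pderiv i : Derivation ℂ (Pol d) (Pol d)).toLinearMap
  cont := by
    refine continuous_of_continuousAt_zero
      (MvPolynomial.pderiv i : Derivation ℂ (Pol d) (Pol d)).toLinearMap ?_
    rw [ContinuousAt, map_zero]
    refine (withSeminorms_pnorm.tendsto_nhds _ _).2 fun n ε hε => ?_
    have := ((continuous_pnorm (d := d) (2 * n + 1)).tendsto 0).eventually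
      (gt_mem_nhds (by simpa using hε))
    filter_upwards [this] with f hf
    rw [sub_zero]
    exact (pnorm_pderiv_le n i f).trans_lt hf

/-- The partial derivative on the completion. -/
def hatDeriv (i : Fin d) : PolHat d →L[ℂ] PolHat d := (pderivCLM i).completion

lemma hatDeriv_coe (i : Fin d) (f : Pol d) :
    hatDeriv i (f : PolHat d) = (MvPolynomial.pderiv i f : Pol d) :=
  (pderivCLM i).completion_apply_coe f

/-- The real-linear form on `ℝ^d` with complex coefficients `c`. -/
def linForm (c : Fin d → ℂ) : (Fin d → ℝ) →L[ℝ] ℂ :=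
  ∑ i, c i • (Complex.ofRealCLM.comp (ContinuousLinearMap.proj i))

lemma linForm_apply (c : Fin d → ℂ) (v : Fin d → ℝ) : linForm c v = ∑ i, c i * v i := by
  simp [linForm]

lemma norm_linForm_sub_le (c c' : Fin d → ℂ) : ‖linForm c - linForm c'‖ ≤ ∑ i, ‖c i - c' i‖ := by
  refine ContinuousLinearMap.opNorm_le_bound _ (Finset.sum_nonneg fun _ _ => norm_nonneg _)
    fun v => ?_
  rw [sub_apply, linForm_apply, linForm_apply, ← Finset.sum_sub_distrib,
    Finset.sum_mul]
  refine (norm_sum_le _ _).trans (Finset.sum_le_sum fun i _ => ?_)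
  rw [← sub_mul, norm_mul, Complex.norm_real]
  exact mul_le_mul_of_nonneg_left (norm_le_pi_norm v i) (norm_nonneg _)

lemma hasFDerivAt_polFun (f : Pol d) (x : Fin d → ℝ) :
    HasFDerivAt (polFun f) (linForm fun i => polFun (MvPolynomial.pderiv i f) x) x := by
  induction f using MvPolynomial.induction_on with
  | C a =>
    have h1 : polFun (MvPolynomial.C a : Pol d) = fun _ => a := by
      funext y
      simp [polFun]
    have h2 : (linForm fun i =>
        polFun (MvPolynomial.pderiv i (MvPolynomial.C a : Pol d)) x) = 0 := by
      ext v
      simp [linForm_apply, polFun]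
    rw [h1, h2]
    exact hasFDerivAt_const _ _
  | add f g hf hg =>
    have h1 : polFun (f + g) = fun y => polFun f y + polFun g y := by
      funext y
      simp [polFun]
    rw [h1]
    refine (hf.add hg).congr_fderiv ?_
    ext v
    simp [linForm_apply, polFun, add_mul, Finset.sum_add_distrib]
  | mul_X f j hf =>
    have h1 : polFun (f * MvPolynomial.X j) = fun y => polFun f y * ((y j : ℝ) : ℂ) := by
      funext y
      simp [polFun]
    have h2 : HasFDerivAt (fun y : Fin d → ℝ => ((y j : ℝ) : ℂ))
        (Complex.ofRealCLM.comp (ContinuousLinearMap.proj j)) x :=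
      (Complex.ofRealCLM.comp
        (ContinuousLinearMap.proj (R := ℝ) (φ := fun _ : Fin d => ℝ) j)).hasFDerivAt
    rw [h1]
    refine (hf.mul h2).congr_fderiv ?_
    ext v
    simp only [linForm_apply, polFun, Derivation.leibniz, map_add, smul_eq_mul, map_mul,
      MvPolynomial.pderiv_X, MvPolynomial.eval_X, add_mul, Finset.sum_add_distrib,
      add_apply, smul_apply,
      ContinuousLinearMap.comp_apply, Complex.ofRealCLM_apply, ContinuousLinearMap.proj_apply,
      Finset.mul_sum]
    congr 1
    · rw [Finset.sum_eq_single j]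
      · simp
      · intro i _ hij
        simp [hij.symm]
      · simp
    · exact Finset.sum_congr rfl fun i _ => by ring

/-- The derivatives of approximating polynomials converge uniformly on balls, so the element of the
completion is differentiable and `hatDeriv` computes its partial derivatives. -/
lemma hasFDerivAt_toFun (f : PolHat d) (x : Fin d → ℝ) :
    HasFDerivAt (toFun f) (linForm fun i => toFun (hatDeriv i f) x) x := by
  have : (comap ((↑) : Pol d → PolHat d) (𝓝 f)).NeBot :=
    UniformSpace.Completion.isDenseInducing_coe.comap_nhds_neBot f
  let l := comap ((↑) : Pol d → PolHat d) (𝓝 f)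
  have hl : Tendsto ((↑) : Pol d → PolHat d) l (𝓝 f) := tendsto_comap
  let n := ⌈‖x‖⌉₊
  have hn : ∀ y ∈ Metric.ball (0 : Fin d → ℝ) (n + 1), ∀ i, |y i| ≤ (n : ℝ) + 1 := fun y hy i =>
    (norm_le_pi_norm y i).trans (by simpa using (Metric.mem_ball.1 hy).le)
  refine hasFDerivAt_of_tendstoUniformlyOn (l := l) (s := Metric.ball (0 : Fin d → ℝ) (n + 1))
    (f := fun p => polFun p) (f' := fun p y => linForm fun i => polFun (MvPolynomial.pderiv i p) y)
    (g' := fun y => linForm fun i => toFun (hatDeriv i f) y) Metric.isOpen_ball ?_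
    (fun p y _ => hasFDerivAt_polFun p y) (fun y _ => ?_) ?_
  · rw [Metric.tendstoUniformlyOn_iff]
    intro ε hε
    have h1 : Continuous fun g : PolHat d => ∑ i, hatNorm n (hatDeriv i f - hatDeriv i g) :=
      continuous_finsetSum _ fun i _ => (continuous_hatNorm n).comp
        (continuous_const.sub (hatDeriv i).continuous)
    have h2 := (h1.tendsto f).comp hl
    simp only [sub_self, map_zero, Finset.sum_const_zero] at h2
    filter_upwards [h2.eventually (gt_mem_nhds hε)] with p hp y hy
    rw [dist_eq_norm]
    refine ((norm_linForm_sub_le _ _).trans (Finset.sum_le_sum fun i _ => ?_)).trans_lt hp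
    rw [← toFun_coe, ← hatDeriv_coe, ← Pi.sub_apply, ← map_sub]
    exact norm_toFun_le (hn y hy) _
  · simp only [← toFun_coe]
    exact ((continuous_toFun y).tendsto f).comp hl
  · rw [Metric.mem_ball, dist_zero_right]
    exact (Nat.le_ceil _).trans_lt (by linarith)

lemma partialDeriv_toFun (i : Fin d) (f : PolHat d) :
    partialDeriv i (toFun f) = toFun (hatDeriv i f) := by
  funext x
  rw [partialDeriv, (hasFDerivAt_toFun f x).fderiv, linForm_apply, Finset.sum_eq_single i]
  · simp
  · intro j _ hj
    simp [hj]
  · simp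

lemma contDiff_toFun (f : PolHat d) : ContDiff ℝ (⊤ : ℕ∞) (toFun f) := by
  refine contDiff_infty.2 fun n => ?_
  induction n generalizing f with
  | zero =>
    exact contDiff_zero.2 (continuous_iff_continuousAt.2 fun x =>
      (hasFDerivAt_toFun f x).continuousAt)
  | succ n ih =>
    refine contDiff_succ_iff_fderiv.2 ⟨fun x => (hasFDerivAt_toFun f x).differentiableAt,
      fun h => (WithTop.natCast_ne_top n h).elim, ?_⟩
    have : fderiv ℝ (toFun f) = fun x => ∑ i, toFun (hatDeriv i f) x •
        (Complex.ofRealCLM.comp (ContinuousLinearMap.proj i) : (Fin d → ℝ) →L[ℝ] ℂ) :=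
      funext fun x => (hasFDerivAt_toFun f x).fderiv
    rw [this]
    exact ContDiff.sum fun i _ => (ih (hatDeriv i f)).smul contDiff_const

/-- The coefficient of `x^L`, as a continuous functional on polynomials. -/
def coeffCLM (L : Fin d →₀ ℕ) : Pol d →L[ℂ] ℂ where
  toLinearMap := MvPolynomial.lcoeff ℂ L
  cont := by
    refine continuous_of_norm_le_pnorm (n := 0) fun f => ?_
    rw [pnorm_apply, MvPolynomial.lcoeff_apply]
    by_cases h : L ∈ f.support
    · simpa using Finset.single_le_sum (f := fun L => ‖MvPolynomial.coeff L f‖)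
        (fun _ _ => norm_nonneg _) h
    · rw [MvPolynomial.notMem_support_iff.1 h, norm_zero]
      positivity

/-- The coefficient of `x^L` of an element of the completion. -/
def hatCoeff (L : Fin d →₀ ℕ) : PolHat d →L[ℂ] ℂ := (coeffCLM L).fromCompletion

lemma hatCoeff_coe (L : Fin d →₀ ℕ) (f : Pol d) :
    hatCoeff L (f : PolHat d) = MvPolynomial.coeff L f :=
  (coeffCLM L).fromCompletion_apply_coe f

lemma sum_hatCoeff_le (n : ℕ) (s : Finset (Fin d →₀ ℕ)) (f : PolHat d) :
    ∑ L ∈ s, ‖hatCoeff L f‖ * ((n : ℝ) + 1) ^ (L.degree ^ 2) ≤ hatNorm n f := by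
  classical
  induction f using UniformSpace.Completion.induction_on with
  | hp =>
    refine isClosed_le (continuous_finsetSum _ fun L _ => ?_) (continuous_hatNorm n)
    exact (hatCoeff L).continuous.norm.mul continuous_const
  | ih f =>
    simp only [hatCoeff_coe, hatNorm_coe, pnorm_apply]
    refine (Finset.sum_le_sum_of_subset_of_nonneg (s.subset_union_left (s₂ := f.support))
      fun _ _ _ => by positivity).trans_eq ?_
    symm
    refine Finset.sum_subset Finset.subset_union_right fun L _ hL => ?_
    simp [MvPolynomial.notMem_support_iff.1 hL]

/-- An element of the completion is determined by its coefficients. -/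
lemma eq_zero_of_hatCoeff {f : PolHat d} (h : ∀ L, hatCoeff L f = 0) : f = 0 := by
  by_contra hf
  obtain ⟨n, hn⟩ := withSeminorms_hatNorm.separating_of_T1 f hf
  have hpos : 0 < hatNorm n f := lt_of_le_of_ne (apply_nonneg _ _) hn.symm
  have ho : IsOpen {g : PolHat d | hatNorm n (f - g) < hatNorm n f / 2} :=
    isOpen_lt ((continuous_hatNorm n).comp (continuous_const.sub continuous_id)) continuous_const
  obtain ⟨p, hp⟩ := UniformSpace.Completion.denseRange_coe.exists_mem_open ho
    ⟨f, by simpa using hpos⟩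
  have h1 : hatNorm n (p : PolHat d) ≤ hatNorm n (f - (p : PolHat d)) := by
    refine le_trans (le_of_eq ?_) (sum_hatCoeff_le n p.support _)
    rw [hatNorm_coe, pnorm_apply]
    refine Finset.sum_congr rfl fun L _ => ?_
    rw [map_sub, h, hatCoeff_coe, zero_sub, norm_neg]
  have h2 : hatNorm n f ≤ hatNorm n (f - (p : PolHat d)) + hatNorm n (p : PolHat d) := by
    simpa using map_add_le_add (hatNorm n) (f - (p : PolHat d)) (p : PolHat d)
  have h3 : hatNorm n (f - (p : PolHat d)) < hatNorm n f / 2 := hp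
  linarith

lemma hatCoeff_hatDeriv (L : Fin d →₀ ℕ) (i : Fin d) (f : PolHat d) :
    hatCoeff L (hatDeriv i f) = hatCoeff (L + Finsupp.single i 1) f * (L i + 1) := by
  induction f using UniformSpace.Completion.induction_on with
  | hp =>
    exact isClosed_eq ((hatCoeff L).continuous.comp (hatDeriv i).continuous)
      ((hatCoeff _).continuous.mul continuous_const)
  | ih f => rw [hatDeriv_coe, hatCoeff_coe, hatCoeff_coe, MvPolynomial.coeff_pderiv]

lemma hatCoeff_zero (f : PolHat d) : hatCoeff 0 f = toFun f 0 := by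
  induction f using UniformSpace.Completion.induction_on with
  | hp => exact isClosed_eq (hatCoeff 0).continuous (continuous_toFun 0)
  | ih f =>
    rw [hatCoeff_coe, toFun_coe, polFun, ← MvPolynomial.constantCoeff_eq]
    simp [MvPolynomial.constantCoeff_eq, MvPolynomial.eval_zero']

/-- The coefficients of an element of the completion are, up to factorials, the partial derivatives
at `0` of the corresponding function. -/
lemma hatCoeff_eq_zero_of_toFun (L : Fin d →₀ ℕ) {f : PolHat d} (hf : toFun f = 0) :
    hatCoeff L f = 0 := by
  induction hn : L.degree generalizing L f with
  | zero =>
    rw [(Finsupp.degree_eq_zero_iff L).1 hn, hatCoeff_zero, hf, Pi.zero_apply]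
  | succ n ih =>
    have hL : L ≠ 0 := by
      rintro rfl
      simp at hn
    obtain ⟨i, hi⟩ := Finsupp.ne_iff.1 hL
    have hle : Finsupp.single i 1 ≤ L := by
      rw [Finsupp.single_le_iff]
      exact Nat.one_le_iff_ne_zero.2 hi
    obtain ⟨L', rfl⟩ : ∃ L', L = L' + Finsupp.single i 1 := ⟨_, (tsub_add_cancel_of_le hle).symm⟩
    have hd : L'.degree = n := by
      simpa using hn
    have h0 : toFun (hatDeriv i f) = 0 := by
      rw [← partialDeriv_toFun, hf]
      funext x
      simp [partialDeriv]
    have h1 := ih L' h0 hd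
    rw [hatCoeff_hatDeriv] at h1
    exact (mul_eq_zero.1 h1).resolve_right (by exact_mod_cast Nat.succ_ne_zero (L' i))

lemma toFun_injective : Function.Injective (toFun (d := d)) := by
  rw [injective_iff_map_eq_zero]
  exact fun f hf => eq_zero_of_hatCoeff fun L => hatCoeff_eq_zero_of_toFun L hf

variable {S : ℂ → PolHat d →ₗ[ℂ] PolHat d →ₗ[ℂ] PolHat d}
  {B : ℕ → PolHat d →ₗ[ℂ] PolHat d →ₗ[ℂ] PolHat d}

/-! ### Estimates and identities on the completion -/

lemma IsContExtension.hatNorm_le {b : Pol d →ₗ[ℂ] Pol d →ₗ[ℂ] Pol d}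
    {b' : PolHat d →ₗ[ℂ] PolHat d →ₗ[ℂ] PolHat d} (h : IsContExtension b b') {m n : ℕ} {M : ℝ}
    (hb : ∀ f g, pnorm n (b f g) ≤ M * (pnorm m f * pnorm m g)) (f g : PolHat d) :
    hatNorm n (b' f g) ≤ M * (hatNorm m f * hatNorm m g) := by
  have hc := h.1
  induction f, g using UniformSpace.Completion.induction_on₂ with
  | hp => exact isClosed_le ((continuous_hatNorm n).comp hc) (by fun_prop)
  | ih f g => simpa only [h.2, hatNorm_coe] using hb f g

lemma IsContExtension.assoc {b : Pol d →ₗ[ℂ] Pol d →ₗ[ℂ] Pol d}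
    {b' : PolHat d →ₗ[ℂ] PolHat d →ₗ[ℂ] PolHat d} (h : IsContExtension b b')
    (hb : ∀ f g h, b (b f g) h = b f (b g h)) (f g k : PolHat d) :
    b' (b' f g) k = b' f (b' g k) := by
  induction f, g, k using UniformSpace.Completion.induction_on₃ with
  | hp =>
    refine isClosed_eq (h.1.comp ((h.1.comp (continuous_fst.prodMk
      (continuous_fst.comp continuous_snd))).prodMk (continuous_snd.comp continuous_snd)))
      (h.1.comp (continuous_fst.prodMk (h.1.comp continuous_snd)))
  | ih f g k => simp only [h.2, hb]

lemma IsContExtension.comm {b : Pol d →ₗ[ℂ] Pol d →ₗ[ℂ] Pol d}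
    {b' : PolHat d →ₗ[ℂ] PolHat d →ₗ[ℂ] PolHat d} (h : IsContExtension b b')
    (hb : ∀ f g, b f g = b g f) (f g : PolHat d) : b' f g = b' g f := by
  induction f, g using UniformSpace.Completion.induction_on₂ with
  | hp => exact isClosed_eq h.1 (h.1.comp continuous_swap)
  | ih f g => rw [h.2, h.2, hb]

lemma IsContExtension.toFun_mul {b : Pol d →ₗ[ℂ] Pol d →ₗ[ℂ] Pol d}
    {b' : PolHat d →ₗ[ℂ] PolHat d →ₗ[ℂ] PolHat d} (h : IsContExtension b b')
    (hb : ∀ f g, b f g = f * g) (f g : PolHat d) : toFun (b' f g) = toFun f * toFun g := by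
  funext x
  rw [Pi.mul_apply]
  have hx := continuous_toFun (d := d) x
  induction f, g using UniformSpace.Completion.induction_on₂ with
  | hp =>
    exact isClosed_eq (hx.comp h.1) ((hx.comp continuous_fst).mul (hx.comp continuous_snd))
  | ih f g =>
    rw [h.2, hb, toFun_coe, toFun_coe, toFun_coe]
    simp [polFun]

/-- The remainders of the expansion of the star product, on the completion. -/
lemma hatNorm_sub_sum_le (hs : IsStarFamily Ω φ s) (hΩ : IsOpen Ω) (h0 : (0 : ℂ) ∈ Ω)
    (hS : ∀ ħ ∈ Ω, IsContExtension (s ħ) (S ħ)) (hB : ∀ k, IsContExtension (starCoeff φ k) (B k))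
    {ρ : ℝ} {m n : ℕ} (hρ : 0 < ρ) (hρΩ : Metric.closedBall 0 ρ ⊆ Ω)
    (hM : ∀ ħ ∈ Metric.closedBall (0 : ℂ) ρ, ∀ f g, pnorm n (s ħ f g) ≤ pnorm m f * pnorm m g)
    {ħ : ℂ} (hħ : ‖ħ‖ < ρ) (t : Finset ℕ) (f g : PolHat d) :
    hatNorm n (S ħ f g - ∑ k ∈ t, ħ ^ k • B k f g) ≤
      geomTail (‖ħ‖ / ρ) t * (hatNorm m f * hatNorm m g) := by
  have hΩħ : ħ ∈ Ω := hρΩ (by simpa using hħ.le)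
  induction f, g using UniformSpace.Completion.induction_on₂ with
  | hp =>
    refine isClosed_le ((continuous_hatNorm n).comp ((hS ħ hΩħ).1.sub
      (continuous_finsetSum _ fun k _ => ?_))) (by fun_prop)
    exact (continuous_const_smul (ħ ^ k)).comp (hB k).1
  | ih f g =>
    have e : S ħ f g - ∑ k ∈ t, ħ ^ k • B k f g =
        ((s ħ f g - ∑ k ∈ t, ħ ^ k • starCoeff φ k f g : Pol d) : PolHat d) := by
      have hsum : ((∑ k ∈ t, ħ ^ k • starCoeff φ k f g : Pol d) : PolHat d) =
          ∑ k ∈ t, ((ħ ^ k • starCoeff φ k f g : Pol d) : PolHat d) :=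
        map_sum (UniformSpace.Completion.toCompl : Pol d →+ PolHat d) _ _
      rw [UniformSpace.Completion.coe_sub, hsum, (hS ħ hΩħ).2]
      simp only [(hB _).2, UniformSpace.Completion.coe_smul]
    rw [e, hatNorm_coe, hatNorm_coe, hatNorm_coe]
    exact hs.pnorm_sub_sum_le hΩ h0 hρ hρΩ hM hħ t f g

/-! ### Dependence on the parameter -/

lemma tendstoUniformlyOn_of_hatNorm {ι X : Type*} {F : ι → X → PolHat d} {f : X → PolHat d}
    {l : Filter ι} {K : Set X}
    (h : ∀ n, ∀ ε > 0, ∀ᶠ i in l, ∀ x ∈ K, hatNorm n (F i x - f x) < ε) :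
    TendstoUniformlyOn F f l K := by
  intro u hu
  rw [uniformity_eq_comap_nhds_zero] at hu
  obtain ⟨V, hV, hVu⟩ := hu
  obtain ⟨⟨t, ε⟩, hε, hVt⟩ := withSeminorms_hatNorm.hasBasis_zero_ball.mem_iff.1 hV
  filter_upwards [h (t.sup id) ε hε] with i hi x hx
  refine hVu (hVt ((Seminorm.mem_ball_zero _).2 ?_))
  have : t.sup (hatNorm (d := d)) ≤ hatNorm (t.sup id) :=
    Finset.sup_le fun _ hi => hatNorm_mono (Finset.le_sup (f := id) hi)
  exact (this _).trans_lt (hi x hx)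

/-- The filter of pairs of polynomials converging to `(f, g)`. -/
def approxFilter (f g : PolHat d) : Filter (Pol d × Pol d) :=
  comap (fun p => ((p.1 : PolHat d), (p.2 : PolHat d))) (𝓝 (f, g))

instance (f g : PolHat d) : (approxFilter f g).NeBot :=
  (UniformSpace.Completion.isDenseInducing_coe.prodMap
    UniformSpace.Completion.isDenseInducing_coe).comap_nhds_neBot (f, g)

lemma tendstoLocallyUniformlyOn_star (hΩ : IsOpen Ω)
    (hS : ∀ ħ ∈ Ω, IsContExtension (s ħ) (S ħ))
    (hbd : HasLocalBounds s Ω) (f g : PolHat d) :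
    TendstoLocallyUniformlyOn (fun (p : Pol d × Pol d) ħ => ((s ħ p.1 p.2 : Pol d) : PolHat d))
      (fun ħ => S ħ f g) (approxFilter f g) Ω := by
  rw [tendstoLocallyUniformlyOn_iff_forall_isCompact hΩ]
  intro C hC hCc
  refine tendstoUniformlyOn_of_hatNorm fun n ε hε => ?_
  obtain ⟨m, hm⟩ := hbd C hC hCc n
  have h1 : Continuous fun x : PolHat d × PolHat d =>
      hatNorm m (x.1 - f) * hatNorm m x.2 + hatNorm m f * hatNorm m (x.2 - g) := by
    fun_prop
  have h2 := (h1.tendsto (f, g)).comp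
    (tendsto_comap (f := fun p : Pol d × Pol d => ((p.1 : PolHat d), (p.2 : PolHat d))))
  simp only [sub_self, map_zero, zero_mul, mul_zero, add_zero] at h2
  filter_upwards [h2.eventually (gt_mem_nhds hε)] with p hp ħ hħ
  have hle : ∀ f g, hatNorm n (S ħ f g) ≤ hatNorm m f * hatNorm m g := by
    simpa using (hS ħ (hC hħ)).hatNorm_le (M := 1) (by simpa using hm ħ hħ)
  have e : ((s ħ p.1 p.2 : Pol d) : PolHat d) - S ħ f g =
      S ħ ((p.1 : PolHat d) - f) p.2 + S ħ f ((p.2 : PolHat d) - g) := by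
    rw [← (hS ħ (hC hħ)).2]
    simp
  rw [e]
  exact ((map_add_le_add _ _ _).trans (add_le_add (hle _ _) (hle _ _))).trans_lt hp

lemma IsFamily.continuousOn {F : ℂ → Pol d} {f : PowerSeries (Pol d)} (h : IsFamily Ω F f) :
    ContinuousOn F Ω := by
  induction h with
  | smul v h => exact h.1.continuousOn.smul continuousOn_const
  | add _ _ h1 h2 => exact h1.add h2

lemma continuousOn_star (hs : IsStarFamily Ω φ s) (hΩ : IsOpen Ω)
    (hS : ∀ ħ ∈ Ω, IsContExtension (s ħ) (S ħ))
    (hbd : HasLocalBounds s Ω) (f g : PolHat d) :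
    ContinuousOn (fun ħ => S ħ f g) Ω :=
  (tendstoLocallyUniformlyOn_star hΩ hS hbd f g).continuousOn (Frequently.of_forall fun p =>
    (UniformSpace.Completion.continuous_coe _).comp_continuousOn (hs p.1 p.2).continuousOn)

lemma isHolomorphic_star (hs : IsStarFamily Ω φ s) (hΩ : IsOpen Ω) (h0 : (0 : ℂ) ∈ Ω)
    (hS : ∀ ħ ∈ Ω, IsContExtension (s ħ) (S ħ))
    (hbd : HasLocalBounds s Ω) (f g : PolHat d) :
    IsHolomorphic Ω (fun ħ => S ħ f g) := by
  intro ψ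
  let ℓ : Pol d →ₗ[ℂ] ℂ :=
    { toFun := fun p => ψ (p : PolHat d)
      map_add' := fun p q => by rw [UniformSpace.Completion.coe_add, map_add]
      map_smul' := fun a p => by rw [UniformSpace.Completion.coe_smul, map_smul]; rfl }
  exact (ψ.uniformContinuous.comp_tendstoLocallyUniformlyOn
    (tendstoLocallyUniformlyOn_star hΩ hS hbd f g)).differentiableOn
      (Eventually.of_forall fun p => (hs.functional hΩ h0 ℓ p.1 p.2).1) hΩ

/-- The extended Poisson bracket, as the commutator of the extension of the first order term of the
star product. -/
def hatBracket (B : ℕ → PolHat d →ₗ[ℂ] PolHat d →ₗ[ℂ] PolHat d) :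
    PolHat d →ₗ[ℂ] PolHat d →ₗ[ℂ] PolHat d :=
  (-Complex.I) • (B 1 - (B 1).flip)

lemma hatBracket_apply (f g : PolHat d) :
    hatBracket B f g = (-Complex.I) • (B 1 f g - B 1 g f) := rfl

lemma toFun_hatBracket {η : PoissonStructure d} (hη : Quantizes φ η)
    (hB : ∀ k, IsContExtension (starCoeff φ k) (B k)) (f g : PolHat d) :
    toFun (hatBracket B f g) = η.bracket (toFun f) (toFun g) := by
  funext x
  simp only [PoissonStructure.bracket, partialDeriv_toFun, hatBracket_apply]
  have hx := continuous_toFun (d := d) x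
  have h1 := (hB 1).1
  induction f, g using UniformSpace.Completion.induction_on₂ with
  | hp =>
    refine isClosed_eq (hx.comp ((continuous_const_smul (-Complex.I)).comp
      (h1.sub (h1.comp continuous_swap)))) ?_
    refine continuous_finsetSum _ fun i _ => continuous_finsetSum _ fun j _ => ?_
    exact (continuous_const.mul (hx.comp ((hatDeriv i).continuous.comp continuous_fst))).mul
      (hx.comp ((hatDeriv j).continuous.comp continuous_snd))
  | ih f g =>
    have e : (-Complex.I) • (starCoeff φ 1 f g - starCoeff φ 1 g f) = polBracket η.comp f g := by
      rw [hη.first_order, smul_smul]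
      simp
    rw [(hB 1).2, (hB 1).2, ← UniformSpace.Completion.coe_sub, ← UniformSpace.Completion.coe_smul,
      e]
    simp only [hatDeriv_coe, toFun_coe]
    simp [polBracket, polFun]

lemma geomTail_range_two_le {θ : ℝ} (h1 : θ ≤ 1 / 2) :
    geomTail θ (Finset.range 2) ≤ 2 * θ ^ 2 := by
  have h : (0 : ℝ) < 1 - θ := by linarith
  have e : geomTail θ (Finset.range 2) = θ ^ 2 / (1 - θ) := by
    simp only [geomTail, Finset.sum_range_succ, Finset.sum_range_zero]
    field_simp
    ring
  rw [e, div_le_iff₀ h]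
  nlinarith [sq_nonneg θ]

/-- The remainder after the first order term of the expansion of the star product is of second
order, which gives the classical limit of the commutators. -/
lemma tendsto_commutator (hs : IsStarFamily Ω φ s) (hΩ : IsOpen Ω) (h0 : (0 : ℂ) ∈ Ω)
    (hS : ∀ ħ ∈ Ω, IsContExtension (s ħ) (S ħ)) (hB : ∀ k, IsContExtension (starCoeff φ k) (B k))
    (hbd : HasLocalBounds s Ω)
    (hcomm : ∀ f g, B 0 f g = B 0 g f) (f g : PolHat d) :
    Tendsto (fun ħ : ℂ => (1 / (Complex.I * ħ)) • (S ħ f g - S ħ g f)) (𝓝[≠] 0)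
      (𝓝 (hatBracket B f g)) := by
  obtain ⟨ρ, hρ, hρΩ⟩ := Metric.nhds_basis_closedBall.mem_iff.1 (hΩ.mem_nhds h0)
  rw [tendsto_iff_hatNorm]
  intro n
  obtain ⟨m, hm⟩ := hbd _ hρΩ (isCompact_closedBall 0 ρ) n
  let c := hatNorm m f * hatNorm m g
  have hlim : Tendsto (fun ħ : ℂ => 4 * c / ρ ^ 2 * ‖ħ‖) (𝓝[≠] 0) (𝓝 0) := by
    have : Continuous fun ħ : ℂ => 4 * c / ρ ^ 2 * ‖ħ‖ := by fun_prop
    simpa using (this.tendsto 0).mono_left nhdsWithin_le_nhds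
  refine squeeze_zero' (Eventually.of_forall fun _ => apply_nonneg _ _) ?_ hlim
  filter_upwards [self_mem_nhdsWithin,
    nhdsWithin_le_nhds (Metric.ball_mem_nhds (0 : ℂ) (half_pos hρ))] with ħ hne hħ
  have hne' : ħ ≠ 0 := hne
  have hħ' : ‖ħ‖ < ρ / 2 := by simpa using hħ
  have hθ : ‖ħ‖ / ρ ≤ 1 / 2 := by
    rw [div_le_iff₀ hρ]
    linarith
  have htail : ∀ f g, hatNorm n (S ħ f g - ∑ k ∈ Finset.range 2, ħ ^ k • B k f g) ≤
      2 * (‖ħ‖ / ρ) ^ 2 * (hatNorm m f * hatNorm m g) := fun f g =>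
    (hatNorm_sub_sum_le hs hΩ h0 hS hB hρ hρΩ hm (by linarith) (Finset.range 2) f g).trans
      (mul_le_mul_of_nonneg_right (geomTail_range_two_le hθ)
        (mul_nonneg (apply_nonneg _ _) (apply_nonneg _ _)))
  have e : (1 / (Complex.I * ħ)) • (S ħ f g - S ħ g f) - hatBracket B f g =
      (1 / (Complex.I * ħ)) • ((S ħ f g - ∑ k ∈ Finset.range 2, ħ ^ k • B k f g) -
        (S ħ g f - ∑ k ∈ Finset.range 2, ħ ^ k • B k g f)) := by
    have hI : (1 / (Complex.I * ħ)) * ħ = -Complex.I := by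
      field_simp
      simp
    simp only [Finset.sum_range_succ, Finset.sum_range_zero, zero_add, pow_zero, one_smul, pow_one,
      hatBracket_apply, ← hI, mul_smul, hcomm g f]
    module
  rw [e, map_smul_eq_mul, norm_div, norm_one, norm_mul, Complex.norm_I, one_mul]
  have hpos : 0 < ‖ħ‖ := norm_pos_iff.2 hne'
  calc 1 / ‖ħ‖ * _ ≤ 1 / ‖ħ‖ * (2 * (‖ħ‖ / ρ) ^ 2 * (hatNorm m f * hatNorm m g) +
        2 * (‖ħ‖ / ρ) ^ 2 * (hatNorm m g * hatNorm m f)) := by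
        gcongr
        exact (map_sub_le_add _ _ _).trans (add_le_add (htail f g) (htail g f))
    _ = 4 * c / ρ ^ 2 * ‖ħ‖ := by
        simp only [c]
        field_simp
        ring

lemma isHolomorphic_commQuotient {P : PolHat d →ₗ[ℂ] PolHat d →ₗ[ℂ] PolHat d} {f g : PolHat d}
    (hΩ : IsOpen Ω) (h0 : (0 : ℂ) ∈ Ω)
    (hol : ∀ f g, IsHolomorphic Ω (fun ħ => S ħ f g)) (hcomm : S 0 f g = S 0 g f)
    (hlim : Tendsto (fun ħ : ℂ => (1 / (Complex.I * ħ)) • (S ħ f g - S ħ g f)) (𝓝[≠] 0)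
      (𝓝 (P f g))) : IsHolomorphic Ω (commQuotient S P f g) := by
  intro ψ
  let h : ℂ → ℂ := fun ħ => ψ (S ħ f g - S ħ g f)
  have hz : h 0 = 0 := by simp [h, hcomm]
  have hd : DifferentiableOn ℂ h Ω := by
    simp only [h, map_sub]
    exact (hol f g ψ).sub (hol g f ψ)
  have hder : HasDerivAt h (Complex.I * ψ (P f g)) 0 := by
    rw [hasDerivAt_iff_tendsto_slope]
    refine (((ψ.continuous.tendsto _).comp hlim).const_mul Complex.I).congr' ?_
    filter_upwards [self_mem_nhdsWithin] with ħ hħ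
    have hne : ħ ≠ 0 := hħ
    rw [slope_def_field, hz, Function.comp_apply, map_smul, smul_eq_mul]
    simp only [h, sub_zero]
    field_simp
  have e : (fun ħ => ψ (commQuotient S P f g ħ)) = fun ħ => (-Complex.I) * dslope h 0 ħ := by
    funext ħ
    by_cases hħ : ħ = 0
    · subst hħ
      rw [dslope_same, hder.deriv, commQuotient, if_pos rfl, ← mul_assoc]
      simp
    · rw [dslope_of_ne _ hħ, slope_def_field, hz, commQuotient, if_neg hħ, map_smul, smul_eq_mul]
      simp only [h, sub_zero]
      field_simp
      simp
  rw [e]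
  exact ((Complex.differentiableOn_dslope (hΩ.mem_nhds h0)).2 hd).const_mul _

variable {r : ℝ} {K : Set ℂ}

/-! ### The power series expansion on discs -/

lemma exists_radius_of_isCompact (hr : Metric.ball (0 : ℂ) r ⊆ Ω) (hK : K ⊆ Metric.ball (0 : ℂ) r)
    (hKc : IsCompact K) (hne : K.Nonempty) :
    ∃ r' ρ : ℝ, 0 < r' ∧ r' < ρ ∧ Metric.closedBall (0 : ℂ) ρ ⊆ Ω ∧ ∀ ħ ∈ K, ‖ħ‖ ≤ r' := by
  obtain ⟨x, hx⟩ := hne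
  have hr0 : 0 < r := Metric.pos_of_mem_ball (hK hx)
  obtain ⟨r', ⟨hr', hr'r⟩, hKr⟩ := exists_pos_lt_subset_ball hr0 hKc.isClosed hK
  obtain ⟨ρ, h1, h2⟩ := exists_between hr'r
  refine ⟨r', ρ, hr', h1, (Metric.closedBall_subset_ball h2).trans hr, fun ħ hħ => ?_⟩
  simpa using (Metric.mem_ball.1 (hKr hħ)).le

/-- On compact subsets of a disc in `Ω` the remainders of the power series of the star product tend
to zero uniformly, along the finite subsets of the set of summation indices. -/
lemma exists_remainder_bound (hs : IsStarFamily Ω φ s) (hΩ : IsOpen Ω) (h0 : (0 : ℂ) ∈ Ω)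
    (hS : ∀ ħ ∈ Ω, IsContExtension (s ħ) (S ħ)) (hB : ∀ k, IsContExtension (starCoeff φ k) (B k))
    (hbd : HasLocalBounds s Ω) (hr : Metric.ball (0 : ℂ) r ⊆ Ω)
    (hK : K ⊆ Metric.ball (0 : ℂ) r) (hKc : IsCompact K) (f g : PolHat d) (n : ℕ) :
    ∃ b : Finset ℕ → ℝ, Tendsto b atTop (𝓝 0) ∧
      ∀ t, ∀ ħ ∈ K, hatNorm n (S ħ f g - ∑ k ∈ t, ħ ^ k • B k f g) ≤ b t := by
  rcases K.eq_empty_or_nonempty with rfl | hne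
  · exact ⟨fun _ => 0, tendsto_const_nhds, by simp⟩
  obtain ⟨r', ρ, hr', hρ, hρΩ, hKr⟩ := exists_radius_of_isCompact hr hK hKc hne
  have hρ0 : 0 < ρ := hr'.trans hρ
  obtain ⟨m, hm⟩ := hbd _ hρΩ (isCompact_closedBall 0 ρ) n
  have h1 : r' / ρ < 1 := (div_lt_one hρ0).2 hρ
  refine ⟨fun t => geomTail (r' / ρ) t * (hatNorm m f * hatNorm m g), ?_, fun t ħ hħ => ?_⟩
  · simpa using (tendsto_geomTail (div_nonneg hr'.le hρ0.le) h1).mul_const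
      (hatNorm m f * hatNorm m g)
  · refine (hatNorm_sub_sum_le hs hΩ h0 hS hB hρ0 hρΩ hm ((hKr ħ hħ).trans_lt hρ) t f g).trans
      (mul_le_mul_of_nonneg_right (geomTail_mono (by positivity) ?_ h1 t)
        (mul_nonneg (apply_nonneg _ _) (apply_nonneg _ _)))
    gcongr
    exact hKr ħ hħ

lemma hasSum_star (hs : IsStarFamily Ω φ s) (hΩ : IsOpen Ω) (h0 : (0 : ℂ) ∈ Ω)
    (hS : ∀ ħ ∈ Ω, IsContExtension (s ħ) (S ħ)) (hB : ∀ k, IsContExtension (starCoeff φ k) (B k))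
    (hbd : HasLocalBounds s Ω) (hr : Metric.ball (0 : ℂ) r ⊆ Ω) {ħ : ℂ}
    (hħ : ħ ∈ Metric.ball (0 : ℂ) r) (f g : PolHat d) :
    HasSum (fun k => ħ ^ k • B k f g) (S ħ f g) := by
  rw [HasSum, SummationFilter.unconditional_filter, tendsto_iff_hatNorm]
  intro n
  obtain ⟨b, hb, hle⟩ := exists_remainder_bound hs hΩ h0 hS hB hbd hr
    (Set.singleton_subset_iff.2 hħ) isCompact_singleton f g n
  refine squeeze_zero (fun _ => apply_nonneg _ _) (fun t => ?_) hb
  rw [map_sub_rev]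
  exact hle t ħ rfl

lemma tendstoUniformlyOn_series (hs : IsStarFamily Ω φ s) (hΩ : IsOpen Ω) (h0 : (0 : ℂ) ∈ Ω)
    (hS : ∀ ħ ∈ Ω, IsContExtension (s ħ) (S ħ)) (hB : ∀ k, IsContExtension (starCoeff φ k) (B k))
    (hbd : HasLocalBounds s Ω) (hr : Metric.ball (0 : ℂ) r ⊆ Ω)
    (hK : K ⊆ Metric.ball (0 : ℂ) r) (hKc : IsCompact K) (f g : PolHat d) :
    TendstoUniformlyOn (fun N ħ => ∑ k ∈ Finset.range N, ħ ^ k • B k f g)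
      (fun ħ => S ħ f g) atTop K := by
  refine tendstoUniformlyOn_of_hatNorm fun n ε hε => ?_
  obtain ⟨b, hb, hle⟩ := exists_remainder_bound hs hΩ h0 hS hB hbd hr hK hKc f g n
  filter_upwards [(hb.comp tendsto_finset_range).eventually (gt_mem_nhds hε)] with N hN ħ hħ
  rw [map_sub_rev]
  exact (hle _ ħ hħ).trans_lt hN

lemma exists_summable_bound (hs : IsStarFamily Ω φ s) (hΩ : IsOpen Ω) (h0 : (0 : ℂ) ∈ Ω)
    (hB : ∀ k, IsContExtension (starCoeff φ k) (B k))
    (hbd : HasLocalBounds s Ω) (hr : Metric.ball (0 : ℂ) r ⊆ Ω)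
    (hK : K ⊆ Metric.ball (0 : ℂ) r) (hKc : IsCompact K) {p : Seminorm ℂ (PolHat d)}
    (hp : Continuous p) (f g : PolHat d) :
    ∃ M : ℕ → ℝ, Summable M ∧ ∀ n, ∀ ħ ∈ K, p (ħ ^ n • B n f g) ≤ M n := by
  rcases K.eq_empty_or_nonempty with rfl | hne
  · exact ⟨fun _ => 0, summable_zero, by simp⟩
  obtain ⟨r', ρ, hr', hρ, hρΩ, hKr⟩ := exists_radius_of_isCompact hr hK hKc hne
  have hρ0 : 0 < ρ := hr'.trans hρ
  obtain ⟨n, c, hc, hpn⟩ := exists_le_hatNorm hp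
  obtain ⟨m, hm⟩ := hbd _ hρΩ (isCompact_closedBall 0 ρ) n
  refine ⟨fun k => (r' / ρ) ^ k * (c * (hatNorm m f * hatNorm m g)),
    (summable_geometric_of_lt_one (div_nonneg hr'.le hρ0.le) ((div_lt_one hρ0).2 hρ)).mul_right _,
    fun k ħ hħ => ?_⟩
  have h1 := (hB k).hatNorm_le (hs.pnorm_starCoeff_le hΩ h0 hρ0 hρΩ hm k) f g
  have h2 := hKr ħ hħ
  have hnn : 0 ≤ hatNorm m f * hatNorm m g := mul_nonneg (apply_nonneg _ _) (apply_nonneg _ _)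
  rw [map_smul_eq_mul, norm_pow]
  calc ‖ħ‖ ^ k * p (B k f g)
      ≤ r' ^ k * (c * ((ρ ^ k)⁻¹ * (hatNorm m f * hatNorm m g))) := by
        gcongr
        exact (hpn _).trans (mul_le_mul_of_nonneg_left h1 hc)
    _ = _ := by simp only [div_pow]; ring

end CombStar

end

theorem theorem3p6 (d : ℕ) (φ : Fin d → Fin d → PowerSeries (Pol d))
    (hφ : ∀ i j, i < j → PowerSeries.constantCoeff (φ j i) = 0)
    (η : PoissonStructure d) (hη : Quantizes φ η)
    (Ω : Set ℂ) (hΩ : IsOpen Ω) (hΩc : IsConnected Ω) (hΩ0 : (0 : ℂ) ∈ Ω)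
    (ha : ∀ i j : Fin d,
      {K | coeffSeries K
        (starProd φ (PowerSeries.C (MvPolynomial.X i)) (PowerSeries.C (MvPolynomial.X j))) ≠ 0}.Finite ∧
      ∀ K, ∃ q : ℂ → ℂ, IsExpansion Ω q (coeffSeries K
        (starProd φ (PowerSeries.C (MvPolynomial.X i)) (PowerSeries.C (MvPolynomial.X j)))))
    (hb : ∃ α : ℝ, ∀ K L : Fin d →₀ ℕ, ∃ N : ℕ, (N : ℝ) ≤ α * (K.degree + L.degree : ℝ) ^ 2 ∧
      IsStandard ((reduce φ)^[N] (wordProduct K L)))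
    (hc : ∃ β : ℝ, ∀ K L J : Fin d →₀ ℕ, coeffSeries J (starProd φ (mon K) (mon L)) ≠ 0 →
      (J.degree : ℝ) ≤ β * (K.degree + L.degree : ℝ)) :
    ∃ s : ℂ → Pol d →ₗ[ℂ] Pol d →ₗ[ℂ] Pol d, IsEvaluation Ω φ s ∧
      (∀ s', IsEvaluation Ω φ s' → ∀ ħ ∈ Ω, s' ħ = s ħ) ∧
      (∀ ħ ∈ Ω, Continuous fun x : Pol d × Pol d => s ħ x.1 x.2) ∧
      ∃ S : ℂ → PolHat d →ₗ[ℂ] PolHat d →ₗ[ℂ] PolHat d,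
        (∀ ħ ∈ Ω, IsContExtension (s ħ) (S ħ) ∧ (∀ S', IsContExtension (s ħ) S' → S' = S ħ) ∧
          ∀ f g h, S ħ (S ħ f g) h = S ħ f (S ħ g h)) ∧
        ∃ ι : PolHat d →ₗ[ℂ] ((Fin d → ℝ) → ℂ), Function.Injective ι ∧
          (∀ p : Pol d, ι (p : PolHat d) = polFun p) ∧ (∀ x, Continuous fun f => ι f x) ∧
          (∃ P : PolHat d →ₗ[ℂ] PolHat d →ₗ[ℂ] PolHat d,
            (∀ f g, ι (P f g) = η.bracket (ι f) (ι g)) ∧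
            ∀ f g, IsHolomorphic Ω (fun ħ => S ħ f g) ∧ IsHolomorphic Ω (commQuotient S P f g)) ∧
          (∃ B' : ℕ → PolHat d →ₗ[ℂ] PolHat d →ₗ[ℂ] PolHat d,
            (∀ n, IsContExtension (starCoeff φ n) (B' n)) ∧
            ∀ r : ℝ, Metric.ball 0 r ⊆ Ω → ∀ f g,
              (∀ ħ ∈ Metric.ball 0 r, HasSum (fun n => ħ ^ n • B' n f g) (S ħ f g)) ∧
              ∀ K ⊆ Metric.ball (0 : ℂ) r, IsCompact K →
                (∀ p : Seminorm ℂ (PolHat d), Continuous p → ∃ M : ℕ → ℝ, Summable M ∧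
                  ∀ n, ∀ ħ ∈ K, p (ħ ^ n • B' n f g) ≤ M n) ∧
                TendstoUniformlyOn (fun N ħ => ∑ n ∈ Finset.range N, ħ ^ n • B' n f g)
                  (fun ħ => S ħ f g) atTop K) ∧
          ∀ ε : ℝ, 0 < ε → (∀ x ∈ Set.Ico 0 ε, (x : ℂ) ∈ Ω) →
            IsStrictQuantization η ε ι (fun x => S x) := by
  obtain ⟨s, hs, hbd⟩ := exists_evaluation hφ hΩ hΩc hΩ0 ha hb hc
  have hev : IsEvaluation Ω φ s := hs.isEvaluation hΩ hΩ0
  have hcont : ∀ ħ ∈ Ω, Continuous fun x : Pol d × Pol d => s ħ x.1 x.2 := fun ħ hħ =>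
    continuous_of_pnorm_le fun n => by
      obtain ⟨m, hm⟩ := hbd {ħ} (Set.singleton_subset_iff.2 hħ) isCompact_singleton n
      exact ⟨m, 1, by simpa only [one_mul] using hm ħ rfl⟩
  -- outside `Ω` the value of `S` is irrelevant
  have hSex : ∀ ħ, ∃ S : PolHat d →ₗ[ℂ] PolHat d →ₗ[ℂ] PolHat d, ħ ∈ Ω →
      IsContExtension (s ħ) S := fun ħ => by
    by_cases hħ : ħ ∈ Ω
    · obtain ⟨S, hS⟩ := exists_isContExtension (hcont ħ hħ)
      exact ⟨S, fun _ => hS⟩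
    · exact ⟨0, fun h => absurd h hħ⟩
  choose S hS using hSex
  obtain ⟨ρ₀, hρ₀, hρ₀Ω⟩ := Metric.nhds_basis_closedBall.mem_iff.1 (hΩ.mem_nhds hΩ0)
  have hBex : ∀ k, ∃ B, IsContExtension (starCoeff φ k) B := fun k =>
    exists_isContExtension (continuous_of_pnorm_le fun n => by
      obtain ⟨m, hm⟩ := hbd _ hρ₀Ω (isCompact_closedBall 0 ρ₀) n
      exact ⟨m, _, hs.pnorm_starCoeff_le hΩ hΩ0 hρ₀ hρ₀Ω hm k⟩)
  choose B hB using hBex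
  have hs0 : ∀ f g, s 0 f g = f * g := fun f g => (hev.zero_eq f g).trans (hη.zeroth_order f g)
  have hassoc : ∀ ħ ∈ Ω, ∀ f g h, S ħ (S ħ f g) h = S ħ f (S ħ g h) := fun ħ hħ =>
    (hS ħ hħ).assoc (hs.assoc hη.assoc hΩ hΩc hΩ0 hħ)
  have hlim : ∀ f g, Tendsto (fun ħ : ℂ => (1 / (Complex.I * ħ)) • (S ħ f g - S ħ g f)) (𝓝[≠] 0)
      (𝓝 (hatBracket B f g)) := tendsto_commutator hs hΩ hΩ0 hS hB hbd
    ((hB 0).comm fun f g => by rw [hη.zeroth_order, hη.zeroth_order, mul_comm])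
  have hol := isHolomorphic_star hs hΩ hΩ0 hS hbd
  refine ⟨s, hev, fun s' hs' ħ hħ => hs'.eq hev hΩ hΩc hΩ0 hħ, hcont, S,
    fun ħ hħ => ⟨hS ħ hħ, fun S' hS' => hS'.unique (hS ħ hħ), hassoc ħ hħ⟩,
    toFun, toFun_injective, toFun_coe, continuous_toFun,
    ⟨hatBracket B, toFun_hatBracket hη hB, fun f g => ⟨hol f g, ?_⟩⟩, ⟨B, hB, ?_⟩, ?_⟩
  · refine isHolomorphic_commQuotient hΩ hΩ0 hol ?_ (hlim f g)
    exact (hS 0 hΩ0).comm (fun f g => by rw [hs0, hs0, mul_comm]) f g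
  · intro r hr f g
    exact ⟨fun ħ hħ => hasSum_star hs hΩ hΩ0 hS hB hbd hr hħ f g, fun K hK hKc =>
      ⟨fun p hp => exists_summable_bound hs hΩ hΩ0 hB hbd hr hK hKc hp f g,
        tendstoUniformlyOn_series hs hΩ hΩ0 hS hB hbd hr hK hKc f g⟩⟩
  · intro ε hε hεΩ
    have hnhds : Tendsto (fun x : ℝ => (x : ℂ)) (𝓝[>] 0) (𝓝[≠] 0) := by
      refine tendsto_nhdsWithin_iff.2 ⟨?_, ?_⟩
      · exact (Complex.continuous_ofReal.tendsto' 0 0 Complex.ofReal_zero).mono_left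
          nhdsWithin_le_nhds
      · filter_upwards [self_mem_nhdsWithin] with x hx
        exact Complex.ofReal_ne_zero.2 (Set.mem_Ioi.1 hx).ne'
    exact
      { pos := hε
        frechet := isFrechetSpace_polHat
        assoc := fun ħ hħ => hassoc ħ (hεΩ ħ hħ)
        continuous := fun ħ hħ => (hS ħ (hεΩ ħ hħ)).1
        injective := toFun_injective
        pol_mem := fun p => ⟨p, toFun_coe p⟩
        smooth := contDiff_toFun
        mul_zero := fun f g => by
          simpa only [Complex.ofReal_zero] using (hS 0 hΩ0).toFun_mul hs0 f g
        bracket_mem := fun f g => ⟨hatBracket B f g, toFun_hatBracket hη hB f g⟩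
        continuousOn := fun f g => (continuousOn_star hs hΩ hS hbd f g).comp
          Complex.continuous_ofReal.continuousOn hεΩ
        limit := fun f g h hh => by
          have : h = hatBracket B f g :=
            toFun_injective (hh.trans (toFun_hatBracket hη hB f g).symm)
          rw [this]
          exact (hlim f g).comp hnhds }
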